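/- Let $d\ge 1$, let $E$ be a finite-dimensional real normed space and $0\le\bar\alpha<\alpha\le 1$. Notation. An axis line segment is a set $\ell=\{x+ce_\mu : c\in[0,\lambda]\}\subset\mathbf T^d=\mathbf R^d/\mathbf Z^d$ with $\lambda\ge0$; its length $|\ell|$ is the least such $\lambda$ (so a full circle has length $1$) and, if $|\ell|>0$, its direction is $\mu$. Let $\mathcal X$ be the set of axis line segments. Two segments of positive length are parallel if they have the same direction $\mu$ and the same projection onto the $\mu$-th axis. A function $A:\mathcal X\to E$ is additive if $A(\ell\cup\bar\ell)=A(\ell)+A(\bar\ell)$ whenever $\ell\cup\bar\ell\in\mathcal X$ and $|\ell\cup\bar\ell|=|\ell|+|\bar\ell|$. Put $$|A|_\alpha=\sup_{|\ell|>0}\frac{|A(\ell)|}{|\ell|^\alpha}+\sup_{\ell\ne\bar\ell\ \text{parallel}}\frac{|A(\ell)-A(\bar\ell)|}{(|\ell|\,d(\ell,\bar\ell))^{\alpha/2}},\qquad d(\ell,\bar\ell)=\inf_{x\in\ell,\,y\in\bar\ell}|x-y|,$$ and let $\Omega_\alpha$ be the space of additive $A$ with $|A|_\alpha<\infty$, normed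 by $|\cdot|_\alpha$. Let $\Lambda_N$ be the lattice $2^{-N}\mathbf Z^d/\mathbf Z^d$. A discrete one-form $A\in\Omega^{1,(N)}$ is an $E$-valued function on the oriented bonds from $x$ to $x\pm2^{-N}e_\mu$ ($x\in\Lambda_N$, $1\le\mu\le d$) that changes sign when a bond is reversed. (Bonds are labelled by $x$, $\mu$ and the sign; so for $N\le 1$, where bonds with different labels may have the same endpoints, they are still distinct, and the values on the bonds $(x,x+2^{-N}e_\mu)$ are arbitrary.) For $M\le N$, $A\in\Omega^{1,(N)}$ is regarded as an element of $\Omega^{1,(M)}$ by summing over the $2^{N-M}$ bonds of $\Lambda_N$ that make up a bond of $\Lambda_M$; an additive function on $\mathcal X$ is regarded as an element of $\Omega^{1,(M)}$ by evaluating it on the bonds. Let $\mathcal X^{(N)}\subset\mathcal X$ be the set of segments that are unions of bonds $(x,x+2^{-N}e_\mu)$ of $\Lambda_N$; $A\in\Omega^{1,(N)}$ is evaluated on $\ell\in\mathcal X^{(N)}$ by summing over these bonds, and $|A|^{(N)}_\alpha$ is defined as $|A|_\alpha$ above but with $\ell,\bar\ell$ restricted to $\mathcal X^{(N)}$. Theorem.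 For every $N\ge0$ let $A^{(N)}$ be an $\Omega^{1,(N)}$-valued random variable (possibly on different probability spaces) such that $(|A^{(N)}|^{(N)}_\alpha)_{N\ge0}$ is a tight family of real random variables. Then there exist a subsequence $(N_k)_{k\ge0}$ and an $\Omega_\alpha$-valued random variable $A$ (measurable for the Borel $\sigma$-algebra of the norm $|\cdot|_{\bar\alpha}$) such that $$A^{(N_k)}\to A\ \text{ in law as } \Omega^{1,(M)}\text{-valued random variables, for every } M\ge0$$ (where only the $k$ with $N_k\ge M$ are considered), and for all $K\ge0$ $$\mathbf P\big[|A|_\alpha>K\big]\le\limsup_{k\to\infty}\mathbf P\big[|A^{(N_k)}|^{(N_k)}_\alpha>K\big].$$ -/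

import Mathlib

open MeasureTheory Filter Topology
open scoped ENNReal

universe u v

noncomputable section

/-- The torus `ℝᵈ/ℤᵈ` with its flat geodesic distance, the `ℓ²`-product of the distances of the
circles `ℝ/ℤ`. -/
abbrev Torus (d : ℕ) : Type := PiLp 2 (fun _ : Fin d => UnitAddCircle)

/-- The point `x + c e_μ`. -/
def Torus.shift {d : ℕ} (x : Torus d) (μ : Fin d) (c : ℝ) : Torus d :=
  x + WithLp.toLp 2 (Pi.single μ (c : UnitAddCircle))

/-! ### Axis line segments -/

/-- The subset `{x + c e_μ | c ∈ [0, lam]}` of the torus. -/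
def segmentSet {d : ℕ} (x : Torus d) (μ : Fin d) (lam : ℝ) : Set (Torus d) :=
  (fun c : ℝ => x.shift μ c) '' Set.Icc 0 lam

/-- The set `𝒳` of axis line segments, which are subsets of the torus. -/
def AxisSegment (d : ℕ) : Type :=
  {ℓ : Set (Torus d) // ∃ (x : Torus d) (μ : Fin d) (lam : ℝ), 0 ≤ lam ∧ ℓ = segmentSet x μ lam}

namespace AxisSegment

variable {d : ℕ}

/-- The underlying subset of the torus. -/
def carrier (ℓ : AxisSegment d) : Set (Torus d) := ℓ.1

/-- The axis line segment `{x + c e_μ | c ∈ [0, lam]}`. -/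
def mk (x : Torus d) (μ : Fin d) (lam : ℝ) (h : 0 ≤ lam) : AxisSegment d :=
  ⟨segmentSet x μ lam, x, μ, lam, h, rfl⟩

/-- The length `|ℓ|`. If `ℓ` is not a full circle, only one `lam` represents it; a full circle is
represented by every `lam ≥ 1`, and its length is `1`. -/
def length (ℓ : AxisSegment d) : ℝ :=
  sInf {lam : ℝ | 0 ≤ lam ∧ ∃ (x : Torus d) (μ : Fin d), ℓ.carrier = segmentSet x μ lam}

/-- `ℓ` has positive length and direction `μ`. -/
def HasDirection (ℓ : AxisSegment d) (μ : Fin d) : Prop :=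
  0 < ℓ.length ∧ ∃ (x : Torus d) (lam : ℝ), 0 ≤ lam ∧ ℓ.carrier = segmentSet x μ lam

/-- Parallel segments: same direction `μ` and same projection onto the `μ`-th axis. -/
def Parallel (ℓ ℓ' : AxisSegment d) : Prop :=
  ∃ μ : Fin d, ℓ.HasDirection μ ∧ ℓ'.HasDirection μ ∧
    (fun x : Torus d => x μ) '' ℓ.carrier = (fun x : Torus d => x μ) '' ℓ'.carrier

/-- `d(ℓ, ℓ') = inf {|x - y| : x ∈ ℓ, y ∈ ℓ'}`. -/
def infDist (ℓ ℓ' : AxisSegment d) : ℝ := sInf (Set.image2 dist ℓ.carrier ℓ'.carrier)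

/-- `ρ(ℓ, ℓ') = |ℓ|^{1/2} d(ℓ, ℓ')^{1/2}`. -/
def rho (ℓ ℓ' : AxisSegment d) : ℝ := √ℓ.length * √(ℓ.infDist ℓ')

/-- `ℓ''` is the union of the joinable segments `ℓ` and `ℓ'`. -/
def IsJoin (ℓ ℓ' ℓ'' : AxisSegment d) : Prop :=
  ℓ''.carrier = ℓ.carrier ∪ ℓ'.carrier ∧ ℓ''.length = ℓ.length + ℓ'.length

end AxisSegment

/-! ### Functions on segments and their norms -/

section Norms

variable {d : ℕ} {E : Type*} [NormedAddCommGroup E]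

/-- Additive functions of axis line segments (the space `Ω`). -/
def AdditiveOnSegments (F : AxisSegment d → E) : Prop :=
  ∀ ℓ ℓ' ℓ'' : AxisSegment d, ℓ.IsJoin ℓ' ℓ'' → F ℓ'' = F ℓ + F ℓ'

/-- `|F|_{α;ρ}`, the supremum being over the distinct parallel segments in `S`. -/
def rhoENorm (α : ℝ) (S : Set (AxisSegment d)) (F : AxisSegment d → E) : ℝ≥0∞ :=
  ⨆ (ℓ ∈ S) (ℓ' ∈ S) (_ : ℓ ≠ ℓ') (_ : ℓ.Parallel ℓ'),
    ENNReal.ofReal (‖F ℓ - F ℓ'‖ / ℓ.rho ℓ' ^ α)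

/-- The `α`-growth norm `|F|_{gr α}`, the supremum being over the segments in `S`. -/
def growthENorm (α : ℝ) (S : Set (AxisSegment d)) (F : AxisSegment d → E) : ℝ≥0∞ :=
  ⨆ (ℓ ∈ S) (_ : 0 < ℓ.length), ENNReal.ofReal (‖F ℓ‖ / ℓ.length ^ α)

/-- `|F|_α = |F|_{gr α} + |F|_{α;ρ}` over the segments in `S`, with values in `[0, ∞]`. -/
def segmentENorm (α : ℝ) (S : Set (AxisSegment d)) (F : AxisSegment d → E) : ℝ≥0∞ :=
  growthENorm α S F + rhoENorm α S F

end Norms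

namespace AxisSegment

variable {d : ℕ}

theorem length_nonneg (ℓ : AxisSegment d) : 0 ≤ ℓ.length :=
  Real.sInf_nonneg fun _ h => h.1

theorem segmentSet_of_one_le (x : Torus d) (μ : Fin d) {lam : ℝ} (h : 1 ≤ lam) :
    segmentSet x μ lam = segmentSet x μ 1 := by
  apply Set.Subset.antisymm
  · rintro _ ⟨c, -, rfl⟩
    refine ⟨Int.fract c, ⟨Int.fract_nonneg c, (Int.fract_lt_one c).le⟩, ?_⟩
    have : ((Int.fract c : ℝ) : UnitAddCircle) = (c : UnitAddCircle) :=
      AddCircle.coe_fract c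
    simp only [Torus.shift, this]
  · exact Set.image_mono (Set.Icc_subset_Icc_right h)

theorem length_le_one (ℓ : AxisSegment d) : ℓ.length ≤ 1 := by
  obtain ⟨x, μ, lam, h0, h⟩ := ℓ.2
  have hb : BddBelow {lam : ℝ | 0 ≤ lam ∧ ∃ (x : Torus d) (μ : Fin d),
      ℓ.carrier = segmentSet x μ lam} := ⟨0, fun _ h => h.1⟩
  rcases le_total lam 1 with h1 | h1
  · exact (csInf_le hb ⟨h0, x, μ, h⟩).trans h1
  · exact csInf_le hb ⟨zero_le_one, x, μ, h.trans (segmentSet_of_one_le x μ h1)⟩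

theorem carrier_nonempty (ℓ : AxisSegment d) : ℓ.carrier.Nonempty := by
  obtain ⟨x, μ, lam, h0, h⟩ := ℓ.2
  refine ⟨x.shift μ 0, ?_⟩
  rw [carrier, h]
  exact ⟨0, ⟨le_rfl, h0⟩, rfl⟩

theorem infDist_le (ℓ ℓ' : AxisSegment d) : ℓ.infDist ℓ' ≤ 2 * d := by
  obtain ⟨x, hx⟩ := ℓ.carrier_nonempty
  obtain ⟨y, hy⟩ := ℓ'.carrier_nonempty
  have hb : BddBelow (Set.image2 dist ℓ.carrier ℓ'.carrier) := by
    refine ⟨0, ?_⟩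
    rintro _ ⟨a, -, b, -, rfl⟩
    exact dist_nonneg
  refine (csInf_le hb ⟨x, hx, y, hy, rfl⟩).trans ?_
  have h1 : ∀ z : UnitAddCircle, ‖z‖ ≤ 1 := fun z =>
    (AddCircle.norm_le_half_period (p := (1 : ℝ)) one_ne_zero).trans (by norm_num)
  rw [dist_eq_norm, PiLp.norm_eq_of_L2]
  refine Real.sqrt_le_iff.2 ⟨by positivity, ?_⟩
  calc ∑ i, ‖(x - y) i‖ ^ 2 ≤ ∑ _i : Fin d, (1 : ℝ) :=
        Finset.sum_le_sum fun i _ => pow_le_one₀ (norm_nonneg _) (h1 _)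
    _ = d := by simp
    _ ≤ (2 * d : ℝ) ^ 2 := by
        have : (d : ℝ) ≤ (d : ℝ) ^ 2 := by exact_mod_cast Nat.le_self_pow two_ne_zero d
        nlinarith

theorem rho_nonneg (ℓ ℓ' : AxisSegment d) : 0 ≤ ℓ.rho ℓ' :=
  mul_nonneg (Real.sqrt_nonneg _) (Real.sqrt_nonneg _)

theorem rho_le (ℓ ℓ' : AxisSegment d) : ℓ.rho ℓ' ≤ √(2 * d) := by
  have h1 : √ℓ.length ≤ 1 := Real.sqrt_le_one.2 ℓ.length_le_one
  have h2 : √(ℓ.infDist ℓ') ≤ √(2 * d) := Real.sqrt_le_sqrt (ℓ.infDist_le ℓ')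
  calc ℓ.rho ℓ' ≤ 1 * √(2 * d) := mul_le_mul h1 h2 (Real.sqrt_nonneg _) zero_le_one
    _ = _ := one_mul _

theorem isJoin_self {ℓ : AxisSegment d} (h : ℓ.length = 0) : ℓ.IsJoin ℓ ℓ :=
  ⟨(Set.union_self _).symm, by simp [h]⟩

end AxisSegment

/-! ### The Banach spaces `Ω_α` -/

section Holder

variable {d : ℕ} {E : Type*} [NormedAddCommGroup E]

theorem le_growthENorm (α : ℝ) {S : Set (AxisSegment d)} (F : AxisSegment d → E)
    {ℓ : AxisSegment d} (hℓ : ℓ ∈ S) (h : 0 < ℓ.length) :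
    ENNReal.ofReal (‖F ℓ‖ / ℓ.length ^ α) ≤ growthENorm α S F :=
  le_iSup_of_le ℓ (le_iSup_of_le hℓ (le_iSup_of_le h le_rfl))

theorem le_rhoENorm (α : ℝ) {S : Set (AxisSegment d)} (F : AxisSegment d → E)
    {ℓ ℓ' : AxisSegment d} (hℓ : ℓ ∈ S) (hℓ' : ℓ' ∈ S) (hne : ℓ ≠ ℓ') (h : ℓ.Parallel ℓ') :
    ENNReal.ofReal (‖F ℓ - F ℓ'‖ / ℓ.rho ℓ' ^ α) ≤ rhoENorm α S F :=
  le_iSup_of_le ℓ (le_iSup_of_le hℓ (le_iSup_of_le ℓ' (le_iSup_of_le hℓ'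
    (le_iSup_of_le hne (le_iSup_of_le h le_rfl)))))

theorem segmentENorm_add_le (α : ℝ) (S : Set (AxisSegment d)) (F G : AxisSegment d → E) :
    segmentENorm α S (F + G) ≤ segmentENorm α S F + segmentENorm α S G := by
  have key : ∀ {a b c r : ℝ}, 0 ≤ a → 0 ≤ b → 0 ≤ r → c ≤ a + b →
      ENNReal.ofReal (c / r) ≤ ENNReal.ofReal (a / r) + ENNReal.ofReal (b / r) := by
    intro a b c r ha hb hr hc
    rw [← ENNReal.ofReal_add (div_nonneg ha hr) (div_nonneg hb hr), ← add_div]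
    exact ENNReal.ofReal_le_ofReal (div_le_div_of_nonneg_right hc hr)
  have h1 : growthENorm α S (F + G) ≤ growthENorm α S F + growthENorm α S G := by
    refine iSup₂_le fun ℓ hℓ => iSup_le fun h => ?_
    refine (key (norm_nonneg (F ℓ)) (norm_nonneg (G ℓ)) (Real.rpow_nonneg h.le _)
      (norm_add_le _ _)).trans ?_
    exact add_le_add (le_growthENorm α F hℓ h) (le_growthENorm α G hℓ h)
  have h2 : rhoENorm α S (F + G) ≤ rhoENorm α S F + rhoENorm α S G := by
    refine iSup₂_le fun ℓ hℓ => iSup₂_le fun ℓ' hℓ' => iSup₂_le fun hne h => ?_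
    refine (key (norm_nonneg (F ℓ - F ℓ')) (norm_nonneg (G ℓ - G ℓ'))
      (Real.rpow_nonneg (ℓ.rho_nonneg ℓ') _) ?_).trans ?_
    · rw [Pi.add_apply, Pi.add_apply, add_sub_add_comm]
      exact norm_add_le _ _
    · exact add_le_add (le_rhoENorm α F hℓ hℓ' hne h) (le_rhoENorm α G hℓ hℓ' hne h)
  calc segmentENorm α S (F + G)
      ≤ (growthENorm α S F + growthENorm α S G) + (rhoENorm α S F + rhoENorm α S G) :=
        add_le_add h1 h2
    _ = _ := add_add_add_comm _ _ _ _

theorem segmentENorm_zero (α : ℝ) (S : Set (AxisSegment d)) :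
    segmentENorm α S (0 : AxisSegment d → E) = 0 := by
  simp [segmentENorm, growthENorm, rhoENorm]

theorem segmentENorm_smul [NormedSpace ℝ E] (α : ℝ) (S : Set (AxisSegment d)) (c : ℝ)
    (F : AxisSegment d → E) :
    segmentENorm α S (c • F) = ENNReal.ofReal ‖c‖ * segmentENorm α S F := by
  have key : ∀ a r : ℝ, ENNReal.ofReal (‖c‖ * a / r) =
      ENNReal.ofReal ‖c‖ * ENNReal.ofReal (a / r) := fun a r => by
    rw [mul_div_assoc, ENNReal.ofReal_mul (norm_nonneg c)]
  simp only [segmentENorm, growthENorm, rhoENorm, mul_add, ENNReal.mul_iSup, Pi.smul_apply,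
    ← smul_sub, norm_smul, key]

theorem segmentENorm_mono_exponent {β α : ℝ} (hβ : 0 ≤ β) (hβα : β ≤ α)
    {F : AxisSegment d → E} (h : segmentENorm α Set.univ F < ⊤) :
    segmentENorm β Set.univ F < ⊤ := by
  obtain ⟨hg, hr⟩ := ENNReal.add_lt_top.1 h
  set C := (growthENorm α Set.univ F).toReal
  set D := (rhoENorm α Set.univ F).toReal
  have hC : ∀ ℓ : AxisSegment d, 0 < ℓ.length → ‖F ℓ‖ ≤ C * ℓ.length ^ α := fun ℓ h =>
    (div_le_iff₀ (Real.rpow_pos_of_pos h _)).1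
      ((ENNReal.ofReal_le_iff_le_toReal hg.ne).1 (le_growthENorm α F (Set.mem_univ ℓ) h))
  have hC0 : 0 ≤ C := ENNReal.toReal_nonneg
  have hD0 : 0 ≤ D := ENNReal.toReal_nonneg
  have hg' : growthENorm β Set.univ F ≤ ENNReal.ofReal C := by
    refine iSup₂_le fun ℓ _ => iSup_le fun h => ENNReal.ofReal_le_ofReal ?_
    rw [div_le_iff₀ (Real.rpow_pos_of_pos h _)]
    exact (hC ℓ h).trans (mul_le_mul_of_nonneg_left
      (Real.rpow_le_rpow_of_exponent_ge h ℓ.length_le_one hβα) hC0)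
  have hr' : rhoENorm β Set.univ F ≤ ENNReal.ofReal (2 * C + D * √(2 * d) ^ (α - β)) := by
    refine iSup₂_le fun ℓ _ => iSup₂_le fun ℓ' _ => iSup₂_le fun hne h =>
      ENNReal.ofReal_le_ofReal ?_
    have hb0 : 0 ≤ D * √(2 * d) ^ (α - β) :=
      mul_nonneg hD0 (Real.rpow_nonneg (Real.sqrt_nonneg _) _)
    rcases (ℓ.rho_nonneg ℓ').eq_or_lt with h0 | h0
    · obtain ⟨μ, h1, h2, -⟩ := h
      have hle : ∀ ℓ : AxisSegment d, 0 < ℓ.length → ‖F ℓ‖ ≤ C := fun ℓ h =>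
        (hC ℓ h).trans (mul_le_of_le_one_right hC0
          (Real.rpow_le_one h.le ℓ.length_le_one (hβ.trans hβα)))
      have hn : ‖F ℓ - F ℓ'‖ ≤ 2 * C := by
        linarith [norm_sub_le (F ℓ) (F ℓ'), hle ℓ h1.1, hle ℓ' h2.1]
      rw [← h0]
      rcases hβ.eq_or_lt with hb | hb
      · rw [← hb, Real.rpow_zero, div_one, hb]; linarith
      · rw [Real.zero_rpow hb.ne', div_zero]; linarith
    · have hD := (ENNReal.ofReal_le_iff_le_toReal hr.ne).1
        (le_rhoENorm α F (Set.mem_univ ℓ) (Set.mem_univ ℓ') hne h)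
      rw [div_le_iff₀ (Real.rpow_pos_of_pos h0 _)] at hD
      have : ‖F ℓ - F ℓ'‖ / ℓ.rho ℓ' ^ β ≤ D * √(2 * d) ^ (α - β) := by
        rw [div_le_iff₀ (Real.rpow_pos_of_pos h0 _)]
        refine hD.trans ?_
        have hs : ℓ.rho ℓ' ^ α = ℓ.rho ℓ' ^ (α - β) * ℓ.rho ℓ' ^ β := by
          rw [← Real.rpow_add h0, sub_add_cancel]
        rw [hs, mul_assoc]
        refine mul_le_mul_of_nonneg_left (mul_le_mul_of_nonneg_right ?_
          (Real.rpow_nonneg h0.le _)) hD0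
        exact Real.rpow_le_rpow h0.le (ℓ.rho_le ℓ') (sub_nonneg.2 hβα)
      linarith
  exact ENNReal.add_lt_top.2 ⟨hg'.trans_lt ENNReal.ofReal_lt_top, hr'.trans_lt ENNReal.ofReal_lt_top⟩

end Holder

section HolderSpace

variable (d : ℕ) (E : Type*) [NormedAddCommGroup E] [NormedSpace ℝ E]

/-- The additive functions `F : 𝒳 → E` with `|F|_α < ∞`. -/
def omegaSubmodule (α : ℝ) : Submodule ℝ (AxisSegment d → E) where
  carrier := {F | AdditiveOnSegments F ∧ segmentENorm α Set.univ F < ⊤}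
  add_mem' := by
    rintro F G ⟨hF, hF'⟩ ⟨hG, hG'⟩
    refine ⟨fun ℓ ℓ' ℓ'' h => ?_,
      (segmentENorm_add_le α _ F G).trans_lt (ENNReal.add_lt_top.2 ⟨hF', hG'⟩)⟩
    simp only [Pi.add_apply, hF ℓ ℓ' ℓ'' h, hG ℓ ℓ' ℓ'' h]
    abel
  zero_mem' := ⟨fun _ _ _ _ => by simp, by simp [segmentENorm_zero]⟩
  smul_mem' := by
    rintro c F ⟨hF, hF'⟩
    refine ⟨fun ℓ ℓ' ℓ'' h => ?_, ?_⟩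
    · simp only [Pi.smul_apply, hF ℓ ℓ' ℓ'' h, smul_add]
    · rw [segmentENorm_smul]
      exact ENNReal.mul_lt_top ENNReal.ofReal_lt_top hF'

/-- The space `Ω_α` of additive functions `F : 𝒳 → E` with `|F|_α < ∞`, normed by `|·|_α`. -/
def Omega (α : ℝ) : Type _ := omegaSubmodule d E α

end HolderSpace

namespace Omega

variable {d : ℕ} {E : Type*} [NormedAddCommGroup E] [NormedSpace ℝ E] {α : ℝ}

instance : AddCommGroup (Omega d E α) := inferInstanceAs (AddCommGroup (omegaSubmodule d E α))

instance : Module ℝ (Omega d E α) := inferInstanceAs (Module ℝ (omegaSubmodule d E α))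

/-- The underlying function on axis line segments. -/
def toFun (A : Omega d E α) : AxisSegment d → E := A.1

instance : Norm (Omega d E α) := ⟨fun A => (segmentENorm α Set.univ A.toFun).toReal⟩

theorem norm_def (A : Omega d E α) : ‖A‖ = (segmentENorm α Set.univ A.toFun).toReal := rfl

theorem core : NormedSpace.Core ℝ (Omega d E α) where
  norm_nonneg _ := ENNReal.toReal_nonneg
  norm_smul c A := by
    change (segmentENorm α Set.univ (c • A.toFun)).toReal = _
    rw [segmentENorm_smul, ENNReal.toReal_mul, ENNReal.toReal_ofReal (norm_nonneg c), norm_def]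
  norm_triangle A B := by
    change (segmentENorm α Set.univ (A.toFun + B.toFun)).toReal ≤ _
    have h := ENNReal.toReal_add A.2.2.ne B.2.2.ne
    refine le_of_le_of_eq ?_ h
    exact ENNReal.toReal_mono (ENNReal.add_lt_top.2 ⟨A.2.2, B.2.2⟩).ne
      (segmentENorm_add_le α _ _ _)
  norm_eq_zero_iff A := by
    constructor
    · intro h
      have h0 : segmentENorm α Set.univ A.toFun = 0 :=
        ((ENNReal.toReal_eq_zero_iff _).1 h).resolve_right A.2.2.ne
      have hg : growthENorm α Set.univ A.toFun = 0 := (add_eq_zero.1 h0).1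
      refine Subtype.ext (funext fun ℓ => ?_)
      change A.toFun ℓ = 0
      rcases ℓ.length_nonneg.eq_or_lt with hl | hl
      · have := A.2.1 ℓ ℓ ℓ (AxisSegment.isJoin_self hl.symm)
        exact left_eq_add.1 this
      · have h1 := le_growthENorm α A.toFun (Set.mem_univ ℓ) hl
        rw [hg, nonpos_iff_eq_zero, ENNReal.ofReal_eq_zero,
          div_le_iff₀ (Real.rpow_pos_of_pos hl _), zero_mul] at h1
        exact norm_le_zero_iff.1 h1
    · rintro rfl
      change (segmentENorm α Set.univ (0 : AxisSegment d → E)).toReal = 0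
      rw [segmentENorm_zero, ENNReal.toReal_zero]

instance : NormedAddCommGroup (Omega d E α) := NormedAddCommGroup.ofCore core

instance : NormedSpace ℝ (Omega d E α) := NormedSpace.ofCore core

instance : MeasurableSpace (Omega d E α) := borel _

instance : BorelSpace (Omega d E α) := ⟨rfl⟩

/-- The inclusion `Ω_α ⊆ Ω_β` for `0 ≤ β ≤ α`. -/
def inclusion {β : ℝ} (hβ : 0 ≤ β) (hβα : β ≤ α) (A : Omega d E α) : Omega d E β :=
  ⟨A.toFun, A.2.1, segmentENorm_mono_exponent hβ hβα A.2.2⟩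

end Omega

/-! ### Lattices and discrete one-forms -/

/-- The lattice `Λ_N`, with `x : Fin d → ℤ/2^N` standing for the point `2^{-N} x` of the torus. -/
abbrev DyadicLattice (d N : ℕ) : Type := Fin d → ZMod (2 ^ N)

/-- The point `2^{-N} x` of the torus. -/
def DyadicLattice.toTorus {d N : ℕ} (x : DyadicLattice d N) : Torus d :=
  WithLp.toLp 2 fun i => ZMod.toAddCircle (x i)

/-- The oriented bonds of `Λ_N`: the bond `(x, μ, s)` goes from `x` to `x + s 2^{-N} e_μ`. -/
structure Bond (d N : ℕ) where
  base : DyadicLattice d N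
  dir : Fin d
  sign : ℤˣ

namespace Bond

variable {d N : ℕ}

/-- The end point `x + s 2^{-N} e_μ` of a bond. -/
def endpoint (b : Bond d N) : DyadicLattice d N :=
  b.base + Pi.single b.dir ((b.sign : ℤ) : ZMod (2 ^ N))

/-- The reversal of a bond. -/
def reverse (b : Bond d N) : Bond d N := ⟨b.endpoint, b.dir, -b.sign⟩

/-- The bond `(x, x + 2^{-N} e_μ)`. -/
def pos (x : DyadicLattice d N) (μ : Fin d) : Bond d N := ⟨x, μ, 1⟩

/-- The positive bond `(x, x + 2^{-N} e_μ)` as an axis line segment. -/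
def segment (N : ℕ) (x : DyadicLattice d N) (μ : Fin d) : AxisSegment d :=
  AxisSegment.mk x.toTorus μ ((2 : ℝ) ^ N)⁻¹ (by positivity)

end Bond

/-- The space `Ω^{1,(N)}` of discrete `E`-valued one-forms on `Λ_N`. -/
def DiscreteOneForm (d : ℕ) (E : Type*) [NormedAddCommGroup E] (N : ℕ) : Type _ :=
  {A : Bond d N → E // ∀ b : Bond d N, A b.reverse = -A b}

namespace DiscreteOneForm

variable {d : ℕ} {E : Type*} [NormedAddCommGroup E] {N : ℕ}

/-- The topology of pointwise convergence; for finite-dimensional `E` it is the usual topology of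
this finite-dimensional space. -/
instance : TopologicalSpace (DiscreteOneForm d E N) :=
  inferInstanceAs (TopologicalSpace {A : Bond d N → E // ∀ b : Bond d N, A b.reverse = -A b})

instance : MeasurableSpace (DiscreteOneForm d E N) := borel _

instance : BorelSpace (DiscreteOneForm d E N) := ⟨rfl⟩

/-- The value `A_μ(x) = A(x, x + 2^{-N} e_μ)`. -/
def val (A : DiscreteOneForm d E N) (x : DyadicLattice d N) (μ : Fin d) : E := A.1 (Bond.pos x μ)

/-- The discrete one-form with given values on the positive bonds. -/
def ofVal (f : DyadicLattice d N → Fin d → E) : DiscreteOneForm d E N :=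
  ⟨fun b => if b.sign = 1 then f b.base b.dir else -f b.endpoint b.dir, by
    rintro ⟨x, μ, s⟩
    rcases Int.units_eq_one_or s with rfl | rfl
    · simp [Bond.reverse, Bond.endpoint, Pi.single_neg]
    · simp [Bond.reverse, Bond.endpoint]⟩

/-- The one-form on `Λ_M` induced by a one-form on `Λ_N`, `M ≤ N`:
`A(x, x + 2^{-M} e_μ) = ∑_{k < 2^{N-M}} A(x + k 2^{-N} e_μ, x + (k+1) 2^{-N} e_μ)`.
The value for `N < M` is irrelevant. -/
def restrict (M : ℕ) (A : DiscreteOneForm d E N) : DiscreteOneForm d E M :=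
  ofVal fun x μ => ∑ k ∈ Finset.range (2 ^ (N - M)),
    A.val ((fun i => (((x i).val * 2 ^ (N - M) : ℕ) : ZMod (2 ^ N))) + Pi.single μ (k : ZMod (2 ^ N)))
      μ

/-- The one-form on `Λ_M` induced by a function on axis line segments. -/
def ofSegments (M : ℕ) (F : AxisSegment d → E) : DiscreteOneForm d E M :=
  ofVal fun x μ => F (Bond.segment M x μ)

end DiscreteOneForm

/-- The set `𝒳^{(N)}` of axis line segments that are unions of bonds of `Λ_N`. -/
def latticeSegments (d N : ℕ) : Set (AxisSegment d) :=
  {ℓ | ∃ B : Set (DyadicLattice d N × Fin d),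
    ℓ.carrier = ⋃ b ∈ B, (Bond.segment N b.1 b.2).carrier}

namespace DiscreteOneForm

variable {d : ℕ} {E : Type*} [NormedAddCommGroup E] {N : ℕ}

open Classical in
/-- A discrete one-form as a function of the segments in `𝒳^{(N)}`: the sum of its values over the
positive bonds that make up the segment. -/
def onSegments (A : DiscreteOneForm d E N) (ℓ : AxisSegment d) : E :=
  ∑ b : DyadicLattice d N × Fin d,
    if (Bond.segment N b.1 b.2).carrier ⊆ ℓ.carrier then A.val b.1 b.2 else 0

/-- The lattice norm `|A|_α^{(N)}` (finite, since `𝒳^{(N)}` is a finite set). -/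
def latticeNorm (α : ℝ) (A : DiscreteOneForm d E N) : ℝ :=
  (segmentENorm α (latticeSegments d N) A.onSegments).toReal

end DiscreteOneForm

end

/-!
The limit is constructed on the space of *lattice families*: choices of an `E`-valued function on
the positive bonds of `Λ_M` for every `M` at once. For finite-dimensional `E` this is a countable
product of proper spaces. A one-form on `Λ_N` defines such a family by restriction to all coarser
lattices (`LatticeFamily.ofDiscrete`), and restriction does not increase the norm, because a
segment of `𝒳^{(M)}` is a segment of `𝒳^{(N)}` and both one-forms take the same value on it
(`DiscreteOneForm.onSegments_restrict`). A bound on the lattice norm bounds every coordinate of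
the family, so tightness of the norms gives tightness of the laws, and Prokhorov's theorem yields
a subsequence converging weakly to a measure `Q` on families (`exists_subseq_tendsto_law`).

Write `totalNorm α x` for the supremum over `M` of the lattice norms of the members of `x`. It is
lower semicontinuous, so the portmanteau theorem applied to the open sets `{totalNorm α > K}`
bounds `Q {totalNorm α > K}` by the limit inferior of the probabilities for the lattice norms; in
particular `totalNorm α` is `Q`-almost surely finite. Likewise `Q`-almost every family is
consistent, that is, its members are restrictions of each other.

A consistent family `x` of finite norm extends to an element of `Ω_α` of norm at most
`totalNorm α x`. On the segment `{p + c e_μ | c ∈ [0, lam]}` the extension is the limit of the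
values `approx` on lattice segments obtained by rounding. Passing from `Λ_M` to `Λ_{M+1}` moves the rounded
segment in the transversal directions by `O(2^{-M})`, controlled by the `ρ`-norm, and changes its
ends by at most one bond each, controlled by the growth norm
(`LatticeFamily.norm_approx_succ_sub_le`), so that the convergence is geometric. The length of the
rounded segments and the distance between two rounded parallel segments converge, so the norm
bounds survive in the limit (`LatticeFamily.IsBounded.segmentENorm_extend_le`). Up to a bounded
number of bonds, `approx` is the sum over all bonds whose base point projects into the segment.
This form depends on the segment only as a set, and together with the count of lattice points in
an arc (`abs_card_latticePoints_sub_le`) it gives additivity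
(`LatticeFamily.IsBounded.additive_extend`) without any case distinction on how the two segments
are joined.

Finally, on a bounded set of consistent families the extension is continuous for the supremum norm
over segments, and interpolation between the supremum norm and `|·|_α` (`Omega.norm_inclusion_le`)
upgrades this to continuity into `Ω_β`. Measurability for the Borel `σ`-algebra of `|·|_β`
follows, although `Ω_β` is not assumed to be separable.
-/

/-! ### Arcs of the circle and axis segments -/

/-- The closed arc of the circle that starts at `a` and runs for length `lam` in the positive
direction. -/
def circleArc (a : UnitAddCircle) (lam : ℝ) : Set UnitAddCircle :=
  (fun c : ℝ => a + (c : UnitAddCircle)) '' Set.Icc 0 lam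

theorem Torus.shift_apply_self {d : ℕ} (x : Torus d) (μ : Fin d) (c : ℝ) :
    (x.shift μ c) μ = x μ + (c : UnitAddCircle) := by
  simp [Torus.shift]

theorem Torus.shift_apply_of_ne {d : ℕ} (x : Torus d) {μ ν : Fin d} (h : ν ≠ μ) (c : ℝ) :
    (x.shift μ c) ν = x ν := by
  simp [Torus.shift, h]

theorem Torus.shift_zero {d : ℕ} (x : Torus d) (μ : Fin d) : x.shift μ 0 = x := by
  simp [Torus.shift]

theorem Torus.shift_shift {d : ℕ} (x : Torus d) (μ : Fin d) (a b : ℝ) :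
    (x.shift μ a).shift μ b = x.shift μ (a + b) := by
  ext ν
  by_cases h : ν = μ
  · subst h
    simp only [Torus.shift_apply_self, AddCircle.coe_add, add_assoc]
  · simp only [Torus.shift_apply_of_ne _ h]

theorem mem_segmentSet {d : ℕ} {x p : Torus d} {μ : Fin d} {lam : ℝ} :
    p ∈ segmentSet x μ lam ↔ (∀ ν, ν ≠ μ → p ν = x ν) ∧ p μ ∈ circleArc (x μ) lam := by
  constructor
  · rintro ⟨c, hc, rfl⟩
    exact ⟨fun ν h => x.shift_apply_of_ne h c, c, hc, (x.shift_apply_self μ c).symm⟩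
  · rintro ⟨h, c, hc, h'⟩
    refine ⟨c, hc, ?_⟩
    ext ν
    by_cases hν : ν = μ
    · subst hν
      rw [← h']
      exact x.shift_apply_self ν c
    · rw [h ν hν]
      exact x.shift_apply_of_ne hν c

theorem self_mem_segmentSet {d : ℕ} (x : Torus d) (μ : Fin d) {lam : ℝ} (h : 0 ≤ lam) :
    x ∈ segmentSet x μ lam :=
  ⟨0, ⟨le_rfl, h⟩, x.shift_zero μ⟩

theorem image_coord_segmentSet {d : ℕ} (x : Torus d) (μ : Fin d) (lam : ℝ) :
    (fun p : Torus d => p μ) '' segmentSet x μ lam = circleArc (x μ) lam := by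
  simp only [segmentSet, circleArc, Set.image_image, Torus.shift_apply_self]

/-- A segment of positive length contains two points that differ only in one coordinate, so any
segment containing it has the same direction and lies on the same line. -/
theorem segmentSet_subset_imp {d : ℕ} {x x' : Torus d} {μ μ' : Fin d} {lam lam' : ℝ}
    (h0 : 0 < lam) (h : segmentSet x μ lam ⊆ segmentSet x' μ' lam') :
    μ = μ' ∧ ∀ ν, ν ≠ μ → x ν = x' ν := by
  have h1 := mem_segmentSet.1 (h (self_mem_segmentSet x μ h0.le))
  have hc : (0 : ℝ) < min lam (1 / 2) := lt_min h0 (by norm_num)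
  have h2 := mem_segmentSet.1 (h ⟨min lam (1 / 2), ⟨hc.le, min_le_left _ _⟩, rfl⟩)
  have hμ : μ = μ' := by
    by_contra hne
    have h3 := h2.1 μ hne
    simp only [Torus.shift_apply_self] at h3
    rw [h1.1 μ hne, add_eq_left, AddCircle.coe_eq_zero_iff_of_mem_Ico] at h3
    · exact hc.ne' h3
    · exact ⟨hc.le, by have := min_le_right lam (1 / 2); linarith⟩
  subst hμ
  exact ⟨rfl, h1.1⟩

/-! ### Lattice points in an arc -/

open Classical in
/-- The points `j` of `ℤ/2^M` such that `2^{-M} j` lies in the subset `T` of the circle. -/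
noncomputable def latticePoints (M : ℕ) (T : Set UnitAddCircle) : Finset (ZMod (2 ^ M)) :=
  Finset.univ.filter fun j => ZMod.toAddCircle j ∈ T

theorem mem_latticePoints {M : ℕ} {T : Set UnitAddCircle} {j : ZMod (2 ^ M)} :
    j ∈ latticePoints M T ↔ ZMod.toAddCircle j ∈ T := by
  simp [latticePoints]

/-- The integers `i` with `⌊2^M t⌋ ≤ i < ⌊2^M (t + lam)⌋`. -/
noncomputable def floorInterval (M : ℕ) (t lam : ℝ) : Finset ℤ :=
  Finset.Ico ⌊2 ^ M * t⌋ ⌊2 ^ M * (t + lam)⌋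

theorem floor_le_floor_add {M : ℕ} (t : ℝ) {lam : ℝ} (h0 : 0 ≤ lam) :
    ⌊2 ^ M * t⌋ ≤ ⌊2 ^ M * (t + lam)⌋ := by
  apply Int.floor_le_floor
  have : (0 : ℝ) < 2 ^ M := by positivity
  nlinarith

theorem floor_add_le_floor {M : ℕ} (t : ℝ) {lam : ℝ} (h1 : lam ≤ 1) :
    ⌊2 ^ M * (t + lam)⌋ ≤ ⌊2 ^ M * t⌋ + 2 ^ M := by
  have h : (2 : ℝ) ^ M * (t + lam) ≤ 2 ^ M * t + ((2 ^ M : ℤ) : ℝ) := by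
    push_cast
    have : (0 : ℝ) < 2 ^ M := by positivity
    nlinarith
  have := Int.floor_le_floor h
  rwa [Int.floor_add_intCast] at this

theorem zmod_intCast_inj_of_lt {M : ℕ} {i j a : ℤ} (hi : a ≤ i) (hi' : i < a + 2 ^ M) (hj : a ≤ j)
    (hj' : j < a + 2 ^ M) (h : (i : ZMod (2 ^ M)) = j) : i = j := by
  rw [ZMod.intCast_eq_intCast_iff_dvd_sub] at h
  push_cast at h
  obtain ⟨k, hk⟩ := h
  have hp : (0 : ℤ) < 2 ^ M := by positivity
  have h1 : k < 1 := by
    by_contra hk1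
    nlinarith
  have h2 : -1 < k := by
    by_contra hk1
    nlinarith
  have : k = 0 := by omega
  rw [this] at hk
  omega

theorem intCast_injOn_floorInterval {M : ℕ} {t lam : ℝ} (h1 : lam ≤ 1) :
    Set.InjOn (fun i : ℤ => (i : ZMod (2 ^ M))) (floorInterval M t lam) := by
  intro i hi j hj h
  have := floor_add_le_floor (M := M) t h1
  simp only [floorInterval, Finset.coe_Ico, Set.mem_Ico] at hi hj
  exact zmod_intCast_inj_of_lt hi.1 (by omega) hj.1 (by omega) h

theorem toAddCircle_intCast_two_pow (M : ℕ) (i : ℤ) :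
    ZMod.toAddCircle (i : ZMod (2 ^ M)) = (((i : ℝ) / 2 ^ M : ℝ) : UnitAddCircle) := by
  rw [ZMod.toAddCircle_intCast]
  push_cast
  rfl

open Classical in
/-- All points of `floorInterval` except possibly the first one lie in the arc. -/
theorem image_floorInterval_sdiff {M : ℕ} (t lam : ℝ) :
    (floorInterval M t lam).image (fun i : ℤ => (i : ZMod (2 ^ M))) \
      latticePoints M (circleArc t lam) ⊆ {((⌊2 ^ M * t⌋ : ℤ) : ZMod (2 ^ M))} := by
  intro j hj
  rw [Finset.mem_sdiff, Finset.mem_image] at hj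
  obtain ⟨⟨i, hi, rfl⟩, hj⟩ := hj
  rw [Finset.mem_singleton]
  by_contra hne
  apply hj
  rw [mem_latticePoints, toAddCircle_intCast_two_pow]
  simp only [floorInterval, Finset.mem_Ico] at hi
  have hlt : ⌊2 ^ M * t⌋ < i := lt_of_le_of_ne hi.1 (fun h => hne (by rw [h]))
  have h1 : 2 ^ M * t < i := Int.floor_lt.1 hlt
  have h2 : (i : ℝ) ≤ 2 ^ M * (t + lam) := Int.le_floor.1 hi.2.le
  have hp : (0 : ℝ) < 2 ^ M := by positivity
  refine ⟨i / 2 ^ M - t, ⟨?_, ?_⟩, ?_⟩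
  · rw [sub_nonneg, le_div_iff₀ hp]; linarith
  · rw [sub_le_iff_le_add, div_le_iff₀ hp]; linarith
  · change (t : UnitAddCircle) + ((i / 2 ^ M - t : ℝ) : UnitAddCircle) = _
    rw [← AddCircle.coe_add]
    congr 1
    ring

theorem circle_coe_eq_coe_iff {s t : ℝ} :
    (s : UnitAddCircle) = t ↔ ∃ n : ℤ, s = t - n := by
  rw [← sub_eq_zero, ← AddCircle.coe_sub, AddCircle.coe_eq_zero_iff]
  constructor
  · rintro ⟨n, hn⟩
    refine ⟨-n, ?_⟩
    simp only [zsmul_eq_mul, mul_one] at hn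
    push_cast
    linarith
  · rintro ⟨n, hn⟩
    refine ⟨-n, ?_⟩
    simp only [zsmul_eq_mul, mul_one]
    push_cast
    linarith

open Classical in
/-- All lattice points in the arc except possibly the last one belong to `floorInterval`. -/
theorem latticePoints_sdiff {M : ℕ} (t lam : ℝ) :
    latticePoints M (circleArc t lam) \
      (floorInterval M t lam).image (fun i : ℤ => (i : ZMod (2 ^ M))) ⊆
      {((⌊2 ^ M * (t + lam)⌋ : ℤ) : ZMod (2 ^ M))} := by
  intro j hj
  rw [Finset.mem_sdiff, mem_latticePoints] at hj
  obtain ⟨⟨c, hc, hj1⟩, hj⟩ := hj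
  obtain ⟨j, rfl⟩ := ZMod.intCast_surjective j
  rw [toAddCircle_intCast_two_pow] at hj1
  change (t : UnitAddCircle) + (c : UnitAddCircle) = _ at hj1
  rw [← AddCircle.coe_add] at hj1
  obtain ⟨n, hn⟩ := circle_coe_eq_coe_iff.1 hj1
  have hp : (0 : ℝ) < 2 ^ M := by positivity
  -- `i` is the integer congruent to `j` such that `2^{-M} i` is `t + c` itself
  set i : ℤ := j - n * 2 ^ M with hi
  have hij : (i : ZMod (2 ^ M)) = j := by
    have h0 : ((2 : ZMod (2 ^ M)) ^ M) = 0 := by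
      have := ZMod.natCast_self (2 ^ M)
      push_cast at this
      exact this
    rw [hi]
    push_cast
    rw [h0]
    ring
  have hit : (i : ℝ) = 2 ^ M * (t + c) := by
    rw [hi, hn]
    push_cast
    field_simp
  have h1 : ⌊2 ^ M * t⌋ ≤ i := by
    have : ⌊2 ^ M * t⌋ ≤ ⌊(i : ℝ)⌋ := Int.floor_le_floor (by rw [hit]; nlinarith [hc.1])
    rwa [Int.floor_intCast] at this
  have h2 : i ≤ ⌊2 ^ M * (t + lam)⌋ := Int.le_floor.2 (by rw [hit]; nlinarith [hc.2])
  rw [Finset.mem_singleton]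
  rcases h2.eq_or_lt with h | h
  · rw [← h, hij]
  · exact absurd (Finset.mem_image.2 ⟨i, Finset.mem_Ico.2 ⟨h1, h⟩, hij⟩) hj

open Classical in
/-- An arc of length `lam` contains `2^M lam + O(1)` points of `2^{-M} ℤ`. -/
theorem abs_card_latticePoints_sub_le {M : ℕ} (a : UnitAddCircle) {lam : ℝ} (h0 : 0 ≤ lam)
    (h1 : lam ≤ 1) : |((latticePoints M (circleArc a lam)).card : ℝ) - 2 ^ M * lam| ≤ 2 := by
  obtain ⟨t, rfl⟩ := QuotientAddGroup.mk_surjective a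
  set J := latticePoints M (circleArc (t : UnitAddCircle) lam)
  set I := (floorInterval M t lam).image (fun i : ℤ => (i : ZMod (2 ^ M)))
  have hI : (I.card : ℤ) = ⌊2 ^ M * (t + lam)⌋ - ⌊2 ^ M * t⌋ := by
    rw [Finset.card_image_of_injOn (intCast_injOn_floorInterval h1), floorInterval, Int.card_Ico,
      Int.toNat_of_nonneg]
    linarith [floor_le_floor_add (M := M) t h0]
  have hIJ : (I \ J).card ≤ 1 := (Finset.card_le_card (image_floorInterval_sdiff t lam)).trans
    (Finset.card_singleton _).le
  have hJI : (J \ I).card ≤ 1 := (Finset.card_le_card (latticePoints_sdiff t lam)).trans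
    (Finset.card_singleton _).le
  have e1 := Finset.card_sdiff_add_card_inter I J
  have e2 := Finset.card_sdiff_add_card_inter J I
  rw [Finset.inter_comm] at e2
  have hI' : (I.card : ℝ) = ⌊2 ^ M * (t + lam)⌋ - ⌊2 ^ M * t⌋ := by exact_mod_cast hI
  have f1 := Int.floor_le (2 ^ M * (t + lam))
  have f2 := Int.lt_floor_add_one (2 ^ M * (t + lam))
  have f3 := Int.floor_le (2 ^ M * t)
  have f4 := Int.lt_floor_add_one (2 ^ M * t)
  have g1 : (J.card : ℝ) ≤ I.card + 1 := by
    have : J.card ≤ I.card + 1 := by omega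
    exact_mod_cast this
  have g2 : (I.card : ℝ) ≤ J.card + 1 := by
    have : I.card ≤ J.card + 1 := by omega
    exact_mod_cast this
  have e : (2 : ℝ) ^ M * (t + lam) = 2 ^ M * t + 2 ^ M * lam := by ring
  rw [abs_le]
  constructor <;> linarith

theorem le_of_forall_two_pow_mul_le {a b C : ℝ} (h : ∀ M : ℕ, 2 ^ M * a ≤ 2 ^ M * b + C) :
    a ≤ b := by
  by_contra! hlt
  obtain ⟨n, hn⟩ := pow_unbounded_of_one_lt (C / (a - b)) (one_lt_two)
  rw [div_lt_iff₀ (sub_pos.2 hlt)] at hn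
  linarith [h n]

theorem circleArc_length_unique {a a' : UnitAddCircle} {lam lam' : ℝ} (h0 : 0 ≤ lam) (h1 : lam ≤ 1)
    (h0' : 0 ≤ lam') (h1' : lam' ≤ 1) (h : circleArc a lam = circleArc a' lam') : lam = lam' := by
  have key : ∀ M : ℕ, |2 ^ M * lam - 2 ^ M * lam'| ≤ 4 := fun M => by
    have e1 := abs_le.1 (abs_card_latticePoints_sub_le (M := M) a h0 h1)
    have e2 := abs_le.1 (abs_card_latticePoints_sub_le (M := M) a' h0' h1')
    rw [h] at e1
    rw [abs_le]
    constructor <;> linarith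
  apply le_antisymm
  · exact le_of_forall_two_pow_mul_le (C := 4) fun M => by linarith [(abs_le.1 (key M)).2]
  · exact le_of_forall_two_pow_mul_le (C := 4) fun M => by linarith [(abs_le.1 (key M)).1]

/-! ### Lengths and distances of segments -/

namespace AxisSegment

variable {d : ℕ}

theorem length_of_carrier_eq {ℓ : AxisSegment d} {x : Torus d} {μ : Fin d} {lam : ℝ} (h0 : 0 ≤ lam)
    (h1 : lam ≤ 1) (h : ℓ.carrier = segmentSet x μ lam) : ℓ.length = lam := by
  have hb : BddBelow {lam : ℝ | 0 ≤ lam ∧ ∃ (x : Torus d) (μ : Fin d),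
      ℓ.carrier = segmentSet x μ lam} := ⟨0, fun _ h => h.1⟩
  refine le_antisymm (csInf_le hb ⟨h0, x, μ, h⟩) (le_csInf ⟨lam, h0, x, μ, h⟩ ?_)
  rintro lam' ⟨h0', x', μ', h'⟩
  rcases h0.eq_or_lt with hl | hl
  · rwa [← hl]
  rcases le_total 1 lam' with h2 | h2
  · exact h1.trans h2
  have hs : segmentSet x μ lam = segmentSet x' μ' lam' := h.symm.trans h'
  obtain ⟨rfl, -⟩ := segmentSet_subset_imp hl hs.subset
  have := congrArg (fun s => (fun p : Torus d => p μ) '' s) hs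
  simp only [image_coord_segmentSet] at this
  exact (circleArc_length_unique h0 h1 h0' h2 this).le

theorem exists_carrier_eq (ℓ : AxisSegment d) :
    ∃ (x : Torus d) (μ : Fin d), ℓ.carrier = segmentSet x μ ℓ.length := by
  obtain ⟨x, μ, lam, h0, h⟩ := ℓ.2
  rcases le_total lam 1 with h1 | h1
  · refine ⟨x, μ, ?_⟩
    rw [length_of_carrier_eq h0 h1 h]
    exact h
  · have h' : ℓ.carrier = segmentSet x μ 1 := h.trans (segmentSet_of_one_le x μ h1)
    refine ⟨x, μ, ?_⟩
    rw [length_of_carrier_eq zero_le_one le_rfl h', h']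

theorem HasDirection.exists_carrier_eq {ℓ : AxisSegment d} {μ : Fin d} (h : ℓ.HasDirection μ) :
    ∃ x : Torus d, ℓ.carrier = segmentSet x μ ℓ.length := by
  obtain ⟨x, μ', hx⟩ := AxisSegment.exists_carrier_eq ℓ
  obtain ⟨h0, y, lam, -, hy⟩ := h
  obtain ⟨rfl, -⟩ := segmentSet_subset_imp h0 (hx.symm.trans hy).subset
  exact ⟨x, hx⟩

/-- Two parallel segments have the same length, and they are represented by base points that
differ only in the directions transversal to them. -/
theorem Parallel.exists_carrier_eq {ℓ ℓ' : AxisSegment d} (h : ℓ.Parallel ℓ') :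
    ∃ (x x' : Torus d) (μ : Fin d), x μ = x' μ ∧ 0 < ℓ.length ∧
      ℓ.carrier = segmentSet x μ ℓ.length ∧ ℓ'.carrier = segmentSet x' μ ℓ.length := by
  obtain ⟨μ, h1, h2, h3⟩ := h
  obtain ⟨x, hx⟩ := h1.exists_carrier_eq
  obtain ⟨x', hx'⟩ := h2.exists_carrier_eq
  rw [hx, hx', image_coord_segmentSet, image_coord_segmentSet] at h3
  have hl := circleArc_length_unique ℓ.length_nonneg ℓ.length_le_one ℓ'.length_nonneg
    ℓ'.length_le_one h3
  refine ⟨x, WithLp.toLp 2 (Function.update (WithLp.ofLp x') μ (x μ)), μ, by simp, h1.1, hx, ?_⟩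
  ext p
  rw [hx', mem_segmentSet, mem_segmentSet]
  have e : (WithLp.toLp 2 (Function.update (WithLp.ofLp x') μ (x μ)) : Torus d) μ = x μ := by simp
  rw [← h3, e]
  refine and_congr_left fun _ => forall₂_congr fun ν hν => ?_
  have : (WithLp.toLp 2 (Function.update (WithLp.ofLp x') μ (x μ)) : Torus d) ν = x' ν := by
    simp [hν]
  rw [this]

theorem infDist_le_dist {ℓ ℓ' : AxisSegment d} {p q : Torus d} (hp : p ∈ ℓ.carrier)
    (hq : q ∈ ℓ'.carrier) : ℓ.infDist ℓ' ≤ dist p q :=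
  csInf_le ⟨0, by rintro _ ⟨a, -, b, -, rfl⟩; exact dist_nonneg⟩ ⟨p, hp, q, hq, rfl⟩

theorem dist_le_infDist {ℓ ℓ' : AxisSegment d} {x x' : Torus d} {μ : Fin d} {lam : ℝ}
    (hx : x μ = x' μ) (h : ℓ.carrier = segmentSet x μ lam)
    (h' : ℓ'.carrier = segmentSet x' μ lam) : dist x x' ≤ ℓ.infDist ℓ' := by
  refine le_csInf ?_ ?_
  · obtain ⟨p, hp⟩ := ℓ.carrier_nonempty
    obtain ⟨q, hq⟩ := ℓ'.carrier_nonempty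
    exact ⟨_, p, hp, q, hq, rfl⟩
  · rintro _ ⟨p, hp, q, hq, rfl⟩
    rw [h, mem_segmentSet] at hp
    rw [h', mem_segmentSet] at hq
    rw [PiLp.dist_eq_of_L2, PiLp.dist_eq_of_L2]
    refine Real.sqrt_le_sqrt (Finset.sum_le_sum fun ν _ => ?_)
    by_cases hν : ν = μ
    · subst hν
      rw [hx, dist_self]
      rw [zero_pow two_ne_zero]
      exact sq_nonneg _
    · rw [hp.1 ν hν, hq.1 ν hν]

end AxisSegment

/-! ### Lattice bonds as segments -/

namespace DyadicLattice

variable {d M N : ℕ}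

/-- The point `2^{-M} x` of `Λ_M` as a point of the finer lattice `Λ_N`, `M ≤ N`. -/
def refine (N : ℕ) (x : DyadicLattice d M) : DyadicLattice d N :=
  fun i => (((x i).val * 2 ^ (N - M) : ℕ) : ZMod (2 ^ N))

/-- The lattice point `x + k e_μ`. -/
def step (x : DyadicLattice d M) (μ : Fin d) (k : ℕ) : DyadicLattice d M :=
  x + Pi.single μ (k : ZMod (2 ^ M))

theorem step_apply_self (x : DyadicLattice d M) (μ : Fin d) (k : ℕ) :
    x.step μ k μ = x μ + (k : ZMod (2 ^ M)) := by
  rw [step, Pi.add_apply, Pi.single_eq_same]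

theorem step_apply_of_ne (x : DyadicLattice d M) {μ ν : Fin d} (h : ν ≠ μ) (k : ℕ) :
    x.step μ k ν = x ν := by
  rw [step, Pi.add_apply, Pi.single_eq_of_ne h, add_zero]

theorem step_zero (x : DyadicLattice d M) (μ : Fin d) : x.step μ 0 = x := by
  simp [step]

theorem toTorus_apply (x : DyadicLattice d M) (i : Fin d) :
    x.toTorus i = ZMod.toAddCircle (x i) := rfl

theorem toTorus_injective : Function.Injective (toTorus : DyadicLattice d M → Torus d) := by
  intro x y h
  funext i
  have := congrArg (fun p : Torus d => p i) h
  simpa [toTorus_apply] using this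

theorem toTorus_refine (h : M ≤ N) (x : DyadicLattice d M) : (x.refine N).toTorus = x.toTorus := by
  ext i
  rw [toTorus_apply, toTorus_apply, refine, ZMod.toAddCircle_natCast, ZMod.toAddCircle_apply]
  congr 1
  obtain ⟨k, rfl⟩ := Nat.exists_eq_add_of_le h
  push_cast
  rw [Nat.add_sub_cancel_left, pow_add]
  field_simp

theorem toTorus_step (x : DyadicLattice d M) (μ : Fin d) (k : ℕ) :
    (x.step μ k).toTorus
      = x.toTorus.shift μ (k * ((2 : ℝ) ^ M)⁻¹) := by
  ext i
  by_cases h : i = μ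
  · subst h
    rw [Torus.shift_apply_self, toTorus_apply, toTorus_apply, step_apply_self, map_add,
      ZMod.toAddCircle_natCast]
    push_cast
    rw [div_eq_mul_inv]
  · rw [Torus.shift_apply_of_ne _ h, toTorus_apply, toTorus_apply, step_apply_of_ne _ h]

theorem refine_self (x : DyadicLattice d M) : x.refine M = x := by
  funext i
  simp [refine]

theorem natCast_inj_of_lt {K a b : ℕ} (ha : a < 2 ^ K) (hb : b < 2 ^ K)
    (h : (a : ZMod (2 ^ K)) = b) : a = b := by
  have := (ZMod.natCast_eq_natCast_iff' _ _ _).1 h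
  rwa [Nat.mod_eq_of_lt ha, Nat.mod_eq_of_lt hb] at this

theorem val_mul_add_lt (h : M ≤ N) (a : ZMod (2 ^ M)) {i : ℕ} (hi : i < 2 ^ (N - M)) :
    a.val * 2 ^ (N - M) + i < 2 ^ N := by
  have h1 : a.val + 1 ≤ 2 ^ M := ZMod.val_lt a
  calc a.val * 2 ^ (N - M) + i < (a.val + 1) * 2 ^ (N - M) := by rw [add_mul]; omega
    _ ≤ 2 ^ M * 2 ^ (N - M) := Nat.mul_le_mul_right _ h1
    _ = 2 ^ N := by rw [← pow_add, Nat.add_sub_cancel' h]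

theorem refine_step_injective (h : M ≤ N) {x y : DyadicLattice d M} {μ : Fin d} {i j : ℕ}
    (hi : i < 2 ^ (N - M)) (hj : j < 2 ^ (N - M))
    (he : (x.refine N).step μ i = (y.refine N).step μ j) :
    x = y ∧ i = j := by
  have hp : 0 < 2 ^ (N - M) := by positivity
  have hμ := congrFun he μ
  simp only [step_apply_self, refine] at hμ
  rw [← Nat.cast_add, ← Nat.cast_add] at hμ
  have hμ' := natCast_inj_of_lt (val_mul_add_lt h _ hi) (val_mul_add_lt h _ hj) hμ
  have e : i = j := by
    have := congrArg (· % 2 ^ (N - M)) hμ'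
    simpa [Nat.add_mod, Nat.mod_eq_of_lt hi, Nat.mod_eq_of_lt hj] using this
  refine ⟨funext fun κ => ?_, e⟩
  apply ZMod.val_injective
  by_cases hκ : κ = μ
  · subst hκ
    rw [e] at hμ'
    exact Nat.eq_of_mul_eq_mul_right hp (Nat.add_right_cancel hμ')
  · have hk := congrFun he κ
    simp only [step_apply_of_ne _ hκ, refine] at hk
    exact Nat.eq_of_mul_eq_mul_right hp
      (natCast_inj_of_lt (by simpa using val_mul_add_lt h (x κ) hp)
        (by simpa using val_mul_add_lt h (y κ) hp) hk)

end DyadicLattice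

theorem segmentSet_mul_eq_iUnion {d : ℕ} (x : Torus d) (μ : Fin d) {k : ℕ} (hk : 1 ≤ k) {δ : ℝ}
    (hδ : 0 < δ) :
    segmentSet x μ (k * δ) = ⋃ i ∈ Finset.range k, segmentSet (x.shift μ (i * δ)) μ δ := by
  apply Set.Subset.antisymm
  · rintro _ ⟨c, ⟨h0, h1⟩, rfl⟩
    have hf : (0 : ℝ) ≤ c / δ := div_nonneg h0 hδ.le
    have hck : c / δ ≤ k := by rwa [div_le_iff₀ hδ]
    -- the right end point belongs to the last of the subsegments
    rcases hck.eq_or_lt with h | h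
    · refine Set.mem_biUnion (x := k - 1) (by simp; omega) ⟨δ, ⟨hδ.le, le_rfl⟩, ?_⟩
      change (x.shift μ _).shift μ δ = x.shift μ c
      rw [Torus.shift_shift, Nat.cast_sub hk, (div_eq_iff hδ.ne').1 h]
      congr 1
      push_cast
      ring
    · refine Set.mem_biUnion (x := ⌊c / δ⌋₊) (by simpa using (Nat.floor_lt hf).2 h)
        ⟨c - ⌊c / δ⌋₊ * δ, ⟨?_, ?_⟩, ?_⟩
      · have := Nat.floor_le hf
        rw [le_div_iff₀ hδ] at this
        linarith
      · have := Nat.lt_floor_add_one (c / δ)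
        rw [div_lt_iff₀ hδ] at this
        linarith
      · change (x.shift μ _).shift μ _ = x.shift μ c
        rw [Torus.shift_shift]
        congr 1
        ring
  · refine Set.iUnion₂_subset fun i hi => ?_
    rintro _ ⟨c, ⟨h0, h1⟩, rfl⟩
    refine ⟨i * δ + c, ⟨by positivity, ?_⟩, (Torus.shift_shift _ _ _ _).symm⟩
    have : (i : ℝ) + 1 ≤ k := by exact_mod_cast Finset.mem_range.1 hi
    nlinarith

namespace Bond

variable {d M N : ℕ}

theorem carrier_segment (x : DyadicLattice d N) (μ : Fin d) :
    (segment N x μ).carrier = segmentSet x.toTorus μ ((2 : ℝ) ^ N)⁻¹ := rfl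

/-- The midpoint of the bond `(x, x + 2^{-N} e_μ)`. -/
noncomputable def midpoint (x : DyadicLattice d N) (μ : Fin d) : Torus d :=
  x.toTorus.shift μ ((2 : ℝ) ^ (N + 1))⁻¹

theorem midpoint_mem (x : DyadicLattice d N) (μ : Fin d) :
    midpoint x μ ∈ (segment N x μ).carrier := by
  refine ⟨((2 : ℝ) ^ (N + 1))⁻¹, ⟨by positivity, ?_⟩, rfl⟩
  exact inv_anti₀ (by positivity) (pow_le_pow_right₀ one_le_two (Nat.le_succ N))

/-- If the midpoint of a bond of `Λ_N` lies on a bond of the coarser lattice `Λ_M`, then the former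
bond is one of the `2^{N-M}` bonds that make up the latter. -/
theorem eq_of_midpoint_mem (h : M ≤ N) {z : DyadicLattice d N} {ν : Fin d}
    {z' : DyadicLattice d M} {ν' : Fin d}
    (hm : midpoint z ν ∈ (segment M z' ν').carrier) :
    ν = ν' ∧ ∃ i : ℕ, i < 2 ^ (N - M) ∧ z = (z'.refine N).step ν i := by
  obtain ⟨k, rfl⟩ := Nat.exists_eq_add_of_le h
  rw [carrier_segment, mem_segmentSet] at hm
  obtain ⟨h1, h2⟩ := hm
  have hpM : (0 : ℝ) < 2 ^ M := by positivity
  have hpk : (0 : ℝ) < 2 ^ k := by positivity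
  have hz : ∀ κ, z.toTorus κ = (((z κ).val / 2 ^ (M + k) : ℝ) : UnitAddCircle) := fun κ => by
    rw [DyadicLattice.toTorus_apply, ZMod.toAddCircle_apply]
    push_cast
    rfl
  have hz' : ∀ κ, z'.toTorus κ = (((z' κ).val / 2 ^ M : ℝ) : UnitAddCircle) := fun κ => by
    rw [DyadicLattice.toTorus_apply, ZMod.toAddCircle_apply]
    push_cast
    rfl
  have hν : ν = ν' := by
    by_contra hne
    have h3 := h1 ν hne
    rw [midpoint, Torus.shift_apply_self, hz, hz', ← AddCircle.coe_add,
      circle_coe_eq_coe_iff] at h3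
    obtain ⟨n, hn⟩ := h3
    have h4 : (2 * ((z ν).val : ℝ) + 1) = 2 * ((z' ν).val * 2 ^ k) - 2 * (n * 2 ^ (M + k)) := by
      generalize ((z ν).val : ℝ) = a at hn ⊢
      rw [pow_succ, pow_add] at hn
      rw [pow_add]
      field_simp at hn
      linarith
    have h5 : (2 * ((z ν).val : ℤ) + 1) = 2 * ((z' ν).val * 2 ^ k) - 2 * (n * 2 ^ (M + k)) := by
      exact_mod_cast h4
    omega
  subst hν
  obtain ⟨c, ⟨hc0, hc1⟩, hc⟩ := h2
  change z'.toTorus ν + (c : UnitAddCircle) = _ at hc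
  rw [midpoint, Torus.shift_apply_self, hz, hz', ← AddCircle.coe_add, ← AddCircle.coe_add,
    circle_coe_eq_coe_iff] at hc
  obtain ⟨n, hn⟩ := hc
  have h4 : 2 ^ (M + k + 1) * c
      = 2 * ((z ν).val : ℝ) + 1 - 2 * ((z' ν).val * 2 ^ k) - 2 * (n * 2 ^ (M + k)) := by
    have : c = (z ν).val / 2 ^ (M + k) + (2 ^ (M + k + 1))⁻¹ - n - (z' ν).val / 2 ^ M := by
      linarith
    rw [this]
    generalize ((z ν).val : ℝ) = a
    rw [pow_succ, pow_add]
    field_simp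
    ring
  -- an odd integer between `0` and `2^{k+1}`
  have h6 : (2 : ℝ) ^ (M + k + 1) * c ≤ 2 * 2 ^ k := by
    calc (2 : ℝ) ^ (M + k + 1) * c ≤ 2 ^ (M + k + 1) * (2 ^ M)⁻¹ :=
          mul_le_mul_of_nonneg_left hc1 (by positivity)
      _ = 2 * 2 ^ k := by
          rw [pow_succ, pow_add]
          field_simp
  have h7 : 0 ≤ (2 : ℝ) ^ (M + k + 1) * c := by positivity
  rw [h4] at h6 h7
  have h6' : 2 * ((z ν).val : ℤ) + 1 - 2 * ((z' ν).val * 2 ^ k) - 2 * (n * 2 ^ (M + k))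
      ≤ 2 * 2 ^ k := by exact_mod_cast h6
  have h7' : 0 ≤ 2 * ((z ν).val : ℤ) + 1 - 2 * ((z' ν).val * 2 ^ k) - 2 * (n * 2 ^ (M + k)) := by
    exact_mod_cast h7
  obtain ⟨i, hi⟩ : ∃ i : ℕ, (i : ℤ) = (z ν).val - (z' ν).val * 2 ^ k - n * 2 ^ (M + k) :=
    ⟨_, Int.toNat_of_nonneg (by omega)⟩
  refine ⟨rfl, i, ?_, ?_⟩
  · rw [Nat.add_sub_cancel_left]
    zify
    omega
  · funext κ
    by_cases hκ : κ = ν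
    · subst hκ
      simp only [DyadicLattice.step_apply_self, DyadicLattice.refine, Nat.add_sub_cancel_left]
      have h8 : ((z κ).val : ℤ) = (z' κ).val * 2 ^ k + i + n * ((2 ^ (M + k) : ℕ) : ℤ) := by
        push_cast
        omega
      have h9 := congrArg (Int.cast : ℤ → ZMod (2 ^ (M + k))) h8
      rw [Int.cast_add, Int.cast_mul, Int.cast_natCast (2 ^ (M + k)), ZMod.natCast_self,
        mul_zero, add_zero] at h9
      simpa using h9
    · have h3 := h1 κ hκ
      rw [midpoint, Torus.shift_apply_of_ne _ hκ, ← DyadicLattice.toTorus_refine h z',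
        DyadicLattice.toTorus_apply, DyadicLattice.toTorus_apply, ZMod.toAddCircle_inj] at h3
      rw [DyadicLattice.step_apply_of_ne _ hκ]
      exact h3

end Bond

/-! ### Discrete one-forms on lattice segments -/

section LatticeSegments

variable {d M N : ℕ}

theorem inv_two_pow_eq_mul (h : M ≤ N) :
    ((2 : ℝ) ^ M)⁻¹ = ((2 ^ (N - M) : ℕ) : ℝ) * (2 ^ N)⁻¹ := by
  obtain ⟨k, rfl⟩ := Nat.exists_eq_add_of_le h
  rw [Nat.add_sub_cancel_left, pow_add]
  push_cast
  field_simp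

theorem carrier_eq_iUnion_segment {ℓ : AxisSegment d} {y : DyadicLattice d N} {μ : Fin d} {k : ℕ}
    (hk : 1 ≤ k) (h : ℓ.carrier = segmentSet y.toTorus μ (k * ((2 : ℝ) ^ N)⁻¹)) :
    ℓ.carrier = ⋃ i ∈ Finset.range k, (Bond.segment N (y.step μ i) μ).carrier := by
  rw [h, segmentSet_mul_eq_iUnion _ _ hk (by positivity)]
  simp only [Bond.carrier_segment, DyadicLattice.toTorus_step]

theorem carrier_segment_eq_refine (h : M ≤ N) (z : DyadicLattice d M) (ν : Fin d) :
    (Bond.segment M z ν).carrier =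
      segmentSet (z.refine N).toTorus ν (((2 ^ (N - M) : ℕ) : ℝ) * ((2 : ℝ) ^ N)⁻¹) := by
  rw [Bond.carrier_segment, DyadicLattice.toTorus_refine h, inv_two_pow_eq_mul h]

theorem carrier_segment_eq_iUnion (h : M ≤ N) (z : DyadicLattice d M) (ν : Fin d) :
    (Bond.segment M z ν).carrier = ⋃ i ∈ Finset.range (2 ^ (N - M)),
      (Bond.segment N ((z.refine N).step ν i) ν).carrier :=
  carrier_eq_iUnion_segment Nat.one_le_two_pow (carrier_segment_eq_refine h z ν)

theorem segment_refine_subset (h : M ≤ N) (z : DyadicLattice d M) (ν : Fin d) {i : ℕ}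
    (hi : i < 2 ^ (N - M)) :
    (Bond.segment N ((z.refine N).step ν i) ν).carrier ⊆ (Bond.segment M z ν).carrier := by
  rw [carrier_segment_eq_iUnion h z ν]
  exact fun p hp => Set.mem_iUnion₂.2 ⟨i, Finset.mem_range.2 hi, hp⟩

theorem mem_latticeSegments {ℓ : AxisSegment d} {y : DyadicLattice d N} {μ : Fin d} {k : ℕ}
    (hk : 1 ≤ k) (h : ℓ.carrier = segmentSet y.toTorus μ (k * ((2 : ℝ) ^ N)⁻¹)) :
    ℓ ∈ latticeSegments d N := by
  refine ⟨(fun i : ℕ => (y.step μ i, μ)) '' (Finset.range k), ?_⟩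
  rw [carrier_eq_iUnion_segment hk h, Set.biUnion_image]
  rfl

/-- A bond lies in a union of bonds of a coarser lattice only if it lies in one of them. -/
theorem exists_segment_subset_of_subset (h : M ≤ N) {ℓ : AxisSegment d} {z : DyadicLattice d N}
    {ν : Fin d} (hℓ : ℓ ∈ latticeSegments d M)
    (hz : (Bond.segment N z ν).carrier ⊆ ℓ.carrier) :
    ∃ z' : DyadicLattice d M, (Bond.segment M z' ν).carrier ⊆ ℓ.carrier ∧
      ∃ i : ℕ, i < 2 ^ (N - M) ∧ z = (z'.refine N).step ν i := by
  obtain ⟨B, hB⟩ := hℓ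
  have := hz (Bond.midpoint_mem z ν)
  rw [hB] at this
  obtain ⟨⟨z', ν'⟩, hb, hm⟩ := Set.mem_iUnion₂.1 this
  obtain ⟨rfl, hi⟩ := Bond.eq_of_midpoint_mem h hm
  refine ⟨z', fun p hp => ?_, hi⟩
  rw [hB]
  exact Set.mem_iUnion₂.2 ⟨_, hb, hp⟩

theorem latticeSegments_mono (h : M ≤ N) : latticeSegments d M ⊆ latticeSegments d N := by
  intro ℓ hℓ
  refine ⟨{b | (Bond.segment N b.1 b.2).carrier ⊆ ℓ.carrier}, ?_⟩
  refine Set.Subset.antisymm ?_ (Set.iUnion₂_subset fun b hb => hb)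
  obtain ⟨B, hB⟩ := id hℓ
  intro p hp
  rw [hB] at hp
  obtain ⟨⟨z', ν⟩, hb, hm⟩ := Set.mem_iUnion₂.1 hp
  have hsub : (Bond.segment M z' ν).carrier ⊆ ℓ.carrier := by
    rw [hB]
    exact fun q hq => Set.mem_iUnion₂.2 ⟨_, hb, hq⟩
  have hm' := hm
  rw [carrier_segment_eq_iUnion h z' ν] at hm'
  obtain ⟨i, hi, hpi⟩ := Set.mem_iUnion₂.1 hm'
  exact Set.mem_iUnion₂.2 ⟨((z'.refine N).step ν i, ν),
    (segment_refine_subset h z' ν (Finset.mem_range.1 hi)).trans hsub, hpi⟩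

theorem finite_latticeSegments (d N : ℕ) : (latticeSegments d N).Finite := by
  refine Set.Finite.of_finite_image (f := AxisSegment.carrier) ?_ (Subtype.val_injective.injOn)
  refine (Set.finite_range fun B : Set (DyadicLattice d N × Fin d) =>
    ⋃ b ∈ B, (Bond.segment N b.1 b.2).carrier).subset ?_
  rintro _ ⟨ℓ, ⟨B, hB⟩, rfl⟩
  exact ⟨B, hB.symm⟩

end LatticeSegments

section Norms

variable {d : ℕ} {E : Type*} [NormedAddCommGroup E]

theorem segmentENorm_lt_top_of_finite (α : ℝ) {S : Set (AxisSegment d)} (hS : S.Finite)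
    (F : AxisSegment d → E) : segmentENorm α S F < ⊤ := by
  have key : ∀ f : AxisSegment d → ℝ≥0∞, (∀ ℓ, f ℓ < ⊤) → ⨆ ℓ ∈ S, f ℓ < ⊤ := fun f hf => by
    refine lt_of_le_of_lt (iSup₂_le fun ℓ hℓ => ?_)
      (ENNReal.sum_lt_top.2 fun ℓ (_ : ℓ ∈ hS.toFinset) => hf ℓ)
    exact Finset.single_le_sum (f := f) (fun _ _ => zero_le) (hS.mem_toFinset.2 hℓ)
  refine ENNReal.add_lt_top.2 ⟨key _ fun ℓ => ?_, key _ fun ℓ => key _ fun ℓ' => ?_⟩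
  · exact (iSup_le fun _ => le_rfl).trans_lt ENNReal.ofReal_lt_top
  · exact (iSup₂_le fun _ _ => le_rfl).trans_lt ENNReal.ofReal_lt_top

theorem growthENorm_congr_mono {α : ℝ} {S T : Set (AxisSegment d)} (h : S ⊆ T)
    {F G : AxisSegment d → E} (hFG : ∀ ℓ ∈ S, F ℓ = G ℓ) :
    growthENorm α S F ≤ growthENorm α T G := by
  refine iSup₂_le fun ℓ hℓ => iSup_le fun h0 => ?_
  rw [hFG ℓ hℓ]
  exact le_growthENorm α G (h hℓ) h0

theorem rhoENorm_congr_mono {α : ℝ} {S T : Set (AxisSegment d)} (h : S ⊆ T)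
    {F G : AxisSegment d → E} (hFG : ∀ ℓ ∈ S, F ℓ = G ℓ) :
    rhoENorm α S F ≤ rhoENorm α T G := by
  refine iSup₂_le fun ℓ hℓ => iSup₂_le fun ℓ' hℓ' => iSup₂_le fun hne hp => ?_
  rw [hFG ℓ hℓ, hFG ℓ' hℓ']
  exact le_rhoENorm α G (h hℓ) (h hℓ') hne hp

end Norms

namespace DiscreteOneForm

variable {d : ℕ} {E : Type*} [NormedAddCommGroup E] {M N : ℕ}

theorem val_ofVal (f : DyadicLattice d N → Fin d → E) : (ofVal f).val = f := by
  funext x μ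
  simp [ofVal, val, Bond.pos]

theorem ofVal_val (A : DiscreteOneForm d E N) : ofVal A.val = A := by
  refine Subtype.ext (funext ?_)
  rintro ⟨x, μ, s⟩
  rcases Int.units_eq_one_or s with rfl | rfl
  · simp [ofVal, val, Bond.pos]
  · have := A.2 ⟨x, μ, -1⟩
    simp only [Bond.reverse, neg_neg] at this
    simp [ofVal, val, Bond.pos, this]

theorem restrict_val (A : DiscreteOneForm d E N) (x : DyadicLattice d M) (μ : Fin d) :
    (A.restrict M).val x μ = ∑ k ∈ Finset.range (2 ^ (N - M)),
      A.val ((x.refine N).step μ k) μ := by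
  rw [restrict, val_ofVal]
  rfl

open Classical in
theorem onSegments_eq_sum_range (A : DiscreteOneForm d E N) {ℓ : AxisSegment d}
    {y : DyadicLattice d N} {μ : Fin d} {k : ℕ} (hk : 1 ≤ k) (hk' : k ≤ 2 ^ N)
    (h : ℓ.carrier = segmentSet y.toTorus μ (k * ((2 : ℝ) ^ N)⁻¹)) :
    A.onSegments ℓ = ∑ i ∈ Finset.range k, A.val (y.step μ i) μ := by
  have hℓ := carrier_eq_iUnion_segment hk h
  have hs : (Finset.univ.filter fun b : DyadicLattice d N × Fin d =>
      (Bond.segment N b.1 b.2).carrier ⊆ ℓ.carrier) =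
      (Finset.range k).image fun i : ℕ => ((y.step μ i), μ) := by
    ext ⟨z, ν⟩
    simp only [Finset.mem_filter, Finset.mem_univ, true_and, Finset.mem_image]
    constructor
    · intro hz
      have hm := hz (Bond.midpoint_mem z ν)
      rw [hℓ] at hm
      obtain ⟨i, hi, hm⟩ := Set.mem_iUnion₂.1 hm
      obtain ⟨rfl, j, hj, hz⟩ := Bond.eq_of_midpoint_mem le_rfl hm
      have : j = 0 := by simpa using hj
      refine ⟨i, hi, ?_⟩
      rw [hz, this, DyadicLattice.refine_self, DyadicLattice.step_zero]
    · rintro ⟨i, hi, he⟩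
      rw [Prod.mk.injEq] at he
      obtain ⟨rfl, rfl⟩ := he
      rw [hℓ]
      exact fun p hp => Set.mem_iUnion₂.2 ⟨i, hi, hp⟩
  rw [onSegments, ← Finset.sum_filter, hs, Finset.sum_image]
  intro i hi j hj he
  simp only [Prod.mk.injEq, and_true] at he
  have := congrFun he μ
  simp only [DyadicLattice.step_apply_self, add_right_inj] at this
  simp only [Finset.coe_range, Set.mem_Iio] at hi hj
  exact DyadicLattice.natCast_inj_of_lt (hi.trans_le hk') (hj.trans_le hk') this

/-- Restriction to a coarser lattice does not change the values on the segments of that lattice. -/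
theorem onSegments_restrict (h : M ≤ N) (A : DiscreteOneForm d E N) {ℓ : AxisSegment d}
    (hℓ : ℓ ∈ latticeSegments d M) : (A.restrict M).onSegments ℓ = A.onSegments ℓ := by
  classical
  simp only [onSegments, ← Finset.sum_filter, restrict_val]
  rw [← Finset.sum_product' (f := fun (b : DyadicLattice d M × Fin d) (k : ℕ) =>
      A.val ((b.1.refine N).step b.2 k) b.2)]
  refine Finset.sum_nbij (fun p : (DyadicLattice d M × Fin d) × ℕ =>
    ((p.1.1.refine N).step p.1.2 p.2, p.1.2)) ?_ ?_ ?_ ?_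
  · rintro ⟨⟨z, ν⟩, i⟩ hp
    simp only [Finset.mem_product, Finset.mem_filter, Finset.mem_univ, true_and,
      Finset.mem_range] at hp ⊢
    exact (segment_refine_subset h z ν hp.2).trans hp.1
  · rintro ⟨⟨z, ν⟩, i⟩ hp ⟨⟨z', ν'⟩, i'⟩ hp' he
    simp only [Finset.coe_product, Finset.coe_range, Set.mem_prod, Set.mem_Iio] at hp hp'
    simp only [Prod.mk.injEq] at he
    obtain ⟨he, rfl⟩ := he
    obtain ⟨rfl, rfl⟩ := DyadicLattice.refine_step_injective h hp.2 hp'.2 he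
    rfl
  · rintro ⟨z, ν⟩ hz
    simp only [Finset.coe_filter, Finset.mem_univ, true_and, Set.mem_ofPred_eq] at hz
    obtain ⟨z', hz', i, hi, rfl⟩ := exists_segment_subset_of_subset h hℓ hz
    refine ⟨((z', ν), i), ?_, rfl⟩
    simp only [Finset.coe_product, Finset.coe_filter, Finset.coe_range, Set.mem_prod,
      Finset.mem_univ, true_and, Set.mem_ofPred_eq, Set.mem_Iio]
    exact ⟨hz', hi⟩
  · rintro ⟨⟨z, ν⟩, i⟩ -
    rfl

theorem restrict_val_eq_onSegments (h : M ≤ N) (A : DiscreteOneForm d E N) (x : DyadicLattice d M)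
    (μ : Fin d) : (A.restrict M).val x μ = A.onSegments (Bond.segment M x μ) := by
  rw [restrict_val, onSegments_eq_sum_range A (y := x.refine N) (μ := μ) (k := 2 ^ (N - M))
    Nat.one_le_two_pow (Nat.pow_le_pow_right two_pos (Nat.sub_le N M))
    (carrier_segment_eq_refine h x μ)]

theorem segment_mem_latticeSegments (x : DyadicLattice d M) (μ : Fin d) :
    Bond.segment M x μ ∈ latticeSegments d M :=
  mem_latticeSegments (k := 1) le_rfl (by rw [Bond.carrier_segment, Nat.cast_one, one_mul])

theorem restrict_restrict {L : ℕ} (h : L ≤ M) (h' : M ≤ N) (A : DiscreteOneForm d E N) :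
    (A.restrict M).restrict L = A.restrict L := by
  rw [← ofVal_val ((A.restrict M).restrict L), ← ofVal_val (A.restrict L)]
  congr 1
  funext x μ
  rw [restrict_val_eq_onSegments h, restrict_val_eq_onSegments (h.trans h'),
    onSegments_restrict h' A (latticeSegments_mono h (segment_mem_latticeSegments x μ))]

theorem growthENorm_restrict_le (α : ℝ) (h : M ≤ N) (A : DiscreteOneForm d E N) :
    growthENorm α (latticeSegments d M) (A.restrict M).onSegments ≤
      growthENorm α (latticeSegments d N) A.onSegments :=
  growthENorm_congr_mono (latticeSegments_mono h) fun _ hℓ => onSegments_restrict h A hℓ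

theorem rhoENorm_restrict_le (α : ℝ) (h : M ≤ N) (A : DiscreteOneForm d E N) :
    rhoENorm α (latticeSegments d M) (A.restrict M).onSegments ≤
      rhoENorm α (latticeSegments d N) A.onSegments :=
  rhoENorm_congr_mono (latticeSegments_mono h) fun _ hℓ => onSegments_restrict h A hℓ

theorem segmentENorm_lt_top (α : ℝ) (A : DiscreteOneForm d E N) :
    segmentENorm α (latticeSegments d N) A.onSegments < ⊤ :=
  segmentENorm_lt_top_of_finite α (finite_latticeSegments d N) _

theorem lt_latticeNorm_iff {α K : ℝ} (hK : 0 ≤ K) (A : DiscreteOneForm d E N) :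
    K < A.latticeNorm α ↔ ENNReal.ofReal K < segmentENorm α (latticeSegments d N) A.onSegments :=
  (ENNReal.ofReal_lt_iff_lt_toReal hK (A.segmentENorm_lt_top α).ne).symm

/-! ### Bounds on sums along lattice lines -/

theorem length_of_lattice {ℓ : AxisSegment d} {y : DyadicLattice d N} {μ : Fin d} {k : ℕ}
    (hk' : k ≤ 2 ^ N) (h : ℓ.carrier = segmentSet y.toTorus μ (k * ((2 : ℝ) ^ N)⁻¹)) :
    ℓ.length = k * ((2 : ℝ) ^ N)⁻¹ := by
  refine AxisSegment.length_of_carrier_eq (by positivity) ?_ h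
  rw [← div_eq_mul_inv, div_le_one (by positivity)]
  exact_mod_cast hk'

theorem norm_sum_range_le {α g : ℝ} (hg : 0 ≤ g) {A : DiscreteOneForm d E N}
    (hA : growthENorm α (latticeSegments d N) A.onSegments ≤ ENNReal.ofReal g)
    (y : DyadicLattice d N) (μ : Fin d) {k : ℕ} (hk' : k ≤ 2 ^ N) :
    ‖∑ i ∈ Finset.range k, A.val (y.step μ i) μ‖ ≤
      g * (k * ((2 : ℝ) ^ N)⁻¹) ^ α := by
  rcases Nat.eq_zero_or_pos k with rfl | hk
  · rw [Finset.range_zero, Finset.sum_empty, norm_zero]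
    exact mul_nonneg hg (Real.rpow_nonneg (by positivity) _)
  set ℓ := AxisSegment.mk y.toTorus μ (k * ((2 : ℝ) ^ N)⁻¹) (by positivity)
  have hℓ : ℓ.carrier = segmentSet y.toTorus μ (k * ((2 : ℝ) ^ N)⁻¹) := rfl
  have hl := length_of_lattice hk' hℓ
  have h0 : 0 < ℓ.length := by rw [hl]; positivity
  have := (le_growthENorm α A.onSegments (mem_latticeSegments hk hℓ) h0).trans hA
  rw [ENNReal.ofReal_le_ofReal_iff hg, div_le_iff₀ (Real.rpow_pos_of_pos h0 _), hl,
    onSegments_eq_sum_range A hk hk' hℓ] at this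
  exact this

theorem norm_sum_range_sub_le {α r : ℝ} (hr : 0 ≤ r) {A : DiscreteOneForm d E N}
    (hA : rhoENorm α (latticeSegments d N) A.onSegments ≤ ENNReal.ofReal r)
    {y y' : DyadicLattice d N} {μ : Fin d} (hy : y μ = y' μ) {k : ℕ} (hk' : k ≤ 2 ^ N) :
    ‖∑ i ∈ Finset.range k, A.val (y.step μ i) μ -
        ∑ i ∈ Finset.range k, A.val (y'.step μ i) μ‖ ≤
      r * (√(k * ((2 : ℝ) ^ N)⁻¹) * √(dist y.toTorus y'.toTorus)) ^ α := by
  have hR : 0 ≤ r * (√(k * ((2 : ℝ) ^ N)⁻¹) * √(dist y.toTorus y'.toTorus)) ^ α :=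
    mul_nonneg hr (Real.rpow_nonneg (by positivity) _)
  rcases Nat.eq_zero_or_pos k with rfl | hk
  · simpa using hR
  by_cases hne : y = y'
  · rw [hne, sub_self, norm_zero]
    rwa [hne] at hR
  set ℓ := AxisSegment.mk y.toTorus μ (k * ((2 : ℝ) ^ N)⁻¹) (by positivity)
  set ℓ' := AxisSegment.mk y'.toTorus μ (k * ((2 : ℝ) ^ N)⁻¹) (by positivity)
  have hℓ : ℓ.carrier = segmentSet y.toTorus μ (k * ((2 : ℝ) ^ N)⁻¹) := rfl
  have hℓ' : ℓ'.carrier = segmentSet y'.toTorus μ (k * ((2 : ℝ) ^ N)⁻¹) := rfl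
  have hl := length_of_lattice hk' hℓ
  have hl' := length_of_lattice hk' hℓ'
  have h0 : 0 < ℓ.length := by rw [hl]; positivity
  have h0' : 0 < ℓ'.length := by rw [hl']; positivity
  have hc : y.toTorus μ = y'.toTorus μ := by
    rw [DyadicLattice.toTorus_apply, DyadicLattice.toTorus_apply, hy]
  have hd : dist y.toTorus y'.toTorus ≤ ℓ.infDist ℓ' := AxisSegment.dist_le_infDist hc hℓ hℓ'
  have hd' : ℓ.infDist ℓ' ≤ dist y.toTorus y'.toTorus :=
    AxisSegment.infDist_le_dist (self_mem_segmentSet _ _ (by positivity))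
      (self_mem_segmentSet _ _ (by positivity))
  have hpos : 0 < dist y.toTorus y'.toTorus :=
    dist_pos.2 fun h => hne (DyadicLattice.toTorus_injective h)
  have hnel : ℓ ≠ ℓ' := by
    intro he
    have h1 : ℓ.infDist ℓ' ≤ dist y.toTorus y.toTorus :=
      AxisSegment.infDist_le_dist (self_mem_segmentSet _ _ (by positivity))
        (by rw [← he]; exact self_mem_segmentSet _ _ (by positivity))
    rw [dist_self] at h1
    linarith
  have hpar : ℓ.Parallel ℓ' := by
    refine ⟨μ, ⟨h0, _, _, by positivity, hℓ⟩, ⟨h0', _, _, by positivity, hℓ'⟩, ?_⟩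
    rw [hℓ, hℓ', image_coord_segmentSet, image_coord_segmentSet, hc]
  have := (le_rhoENorm α A.onSegments (mem_latticeSegments hk hℓ) (mem_latticeSegments hk hℓ')
    hnel hpar).trans hA
  have hrho : ℓ.rho ℓ' = √(k * ((2 : ℝ) ^ N)⁻¹) * √(dist y.toTorus y'.toTorus) := by
    rw [AxisSegment.rho, hl, le_antisymm hd' hd]
  have hrp : 0 < ℓ.rho ℓ' := by rw [hrho]; positivity
  rw [ENNReal.ofReal_le_ofReal_iff hr, div_le_iff₀ (Real.rpow_pos_of_pos hrp _), hrho,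
    onSegments_eq_sum_range A hk hk' hℓ, onSegments_eq_sum_range A hk hk' hℓ'] at this
  exact this

end DiscreteOneForm

/-! ### Lattice approximation of points -/

theorem dist_circle_coe_le (s t : ℝ) : dist (s : UnitAddCircle) (t : UnitAddCircle) ≤ |s - t| := by
  rw [dist_eq_norm, ← AddCircle.coe_sub, UnitAddCircle.norm_eq]
  simpa using round_le (s - t) 0

theorem torus_dist_le {d : ℕ} {p q : Torus d} {ε : ℝ} (h0 : 0 ≤ ε)
    (h : ∀ i, dist (p i) (q i) ≤ ε) : dist p q ≤ d * ε := by
  rw [PiLp.dist_eq_of_L2]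
  refine Real.sqrt_le_iff.2 ⟨by positivity, ?_⟩
  calc ∑ i, dist (p i) (q i) ^ 2 ≤ ∑ _i : Fin d, ε ^ 2 :=
        Finset.sum_le_sum fun i _ => pow_le_pow_left₀ dist_nonneg (h i) 2
    _ = d * ε ^ 2 := by simp
    _ ≤ (d * ε) ^ 2 := by
        have : (d : ℝ) ≤ (d : ℝ) ^ 2 := by exact_mod_cast Nat.le_self_pow two_ne_zero d
        nlinarith [sq_nonneg ε]

/-- The lattice point `y` with its `μ`-th coordinate replaced by `j`. -/
def DyadicLattice.setCoord {d M : ℕ} (y : DyadicLattice d M) (μ : Fin d) (j : ZMod (2 ^ M)) :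
    DyadicLattice d M :=
  Function.update y μ j

theorem DyadicLattice.setCoord_apply_self {d M : ℕ} (y : DyadicLattice d M) (μ : Fin d)
    (j : ZMod (2 ^ M)) : y.setCoord μ j μ = j :=
  Function.update_self ..

theorem DyadicLattice.setCoord_apply_of_ne {d M : ℕ} (y : DyadicLattice d M) {μ ν : Fin d}
    (h : ν ≠ μ) (j : ZMod (2 ^ M)) : y.setCoord μ j ν = y ν :=
  Function.update_of_ne h ..

/-- A real representative of a point of the circle. -/
noncomputable def circleLift (a : UnitAddCircle) : ℝ := Quotient.out a

theorem coe_circleLift (a : UnitAddCircle) : ((circleLift a : ℝ) : UnitAddCircle) = a :=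
  QuotientAddGroup.out_eq' a

/-- The point `2^{-M} ⌊2^M p⌋` of `Λ_M`, with the floor taken in each coordinate of a real
representative of `p`. -/
noncomputable def floorPoint {d : ℕ} (M : ℕ) (p : Torus d) : DyadicLattice d M :=
  fun ν => ((⌊2 ^ M * circleLift (p ν)⌋ : ℤ) : ZMod (2 ^ M))

theorem abs_floor_div_sub_le (M : ℕ) (t : ℝ) : |(⌊2 ^ M * t⌋ : ℝ) / 2 ^ M - t| ≤ (2 ^ M)⁻¹ := by
  have hp : (0 : ℝ) < 2 ^ M := by positivity
  have e : (⌊2 ^ M * t⌋ : ℝ) / 2 ^ M - t = (⌊2 ^ M * t⌋ - 2 ^ M * t) * (2 ^ M)⁻¹ := by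
    field_simp
  rw [e, abs_mul, abs_of_pos (inv_pos.2 hp)]
  refine mul_le_of_le_one_left (inv_pos.2 hp).le ?_
  rw [abs_le]
  constructor <;> linarith [Int.floor_le (2 ^ M * t), Int.lt_floor_add_one (2 ^ M * t)]

theorem dist_toTorus_floorPoint_apply_le {d : ℕ} (M : ℕ) (p : Torus d) (ν : Fin d) :
    dist ((floorPoint M p).toTorus ν) (p ν) ≤ (2 ^ M)⁻¹ := by
  have h := dist_circle_coe_le ((⌊2 ^ M * circleLift (p ν)⌋ : ℝ) / 2 ^ M) (circleLift (p ν))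
  rw [coe_circleLift, ← toAddCircle_intCast_two_pow] at h
  exact h.trans (abs_floor_div_sub_le M _)

theorem dist_toTorus_floorPoint_le {d : ℕ} (M : ℕ) (p : Torus d) :
    dist (floorPoint M p).toTorus p ≤ d * (2 ^ M)⁻¹ :=
  torus_dist_le (by positivity) (dist_toTorus_floorPoint_apply_le M p)

theorem tendsto_inv_two_pow : Tendsto (fun M : ℕ => ((2 : ℝ) ^ M)⁻¹) atTop (𝓝 0) :=
  tendsto_inv_atTop_zero.comp (tendsto_pow_atTop_atTop_of_one_lt one_lt_two)

theorem tendsto_toTorus_floorPoint {d : ℕ} (p : Torus d) :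
    Tendsto (fun M => (floorPoint M p).toTorus) atTop (𝓝 p) := by
  rw [tendsto_iff_dist_tendsto_zero]
  refine squeeze_zero (fun _ => dist_nonneg) (fun M => dist_toTorus_floorPoint_le M p) ?_
  simpa using tendsto_inv_two_pow.const_mul (d : ℝ)

/-- The number of elements of `floorInterval M t lam`. -/
noncomputable def floorCount (M : ℕ) (t lam : ℝ) : ℕ :=
  (⌊2 ^ M * (t + lam)⌋ - ⌊2 ^ M * t⌋).toNat

theorem floorCount_le {M : ℕ} (t : ℝ) {lam : ℝ} (h1 : lam ≤ 1) : floorCount M t lam ≤ 2 ^ M := by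
  rw [floorCount, Int.toNat_le]
  push_cast
  linarith [floor_add_le_floor (M := M) t h1]

theorem tendsto_floorCount (t : ℝ) {lam : ℝ} (h0 : 0 ≤ lam) :
    Tendsto (fun M => (floorCount M t lam : ℝ) * ((2 : ℝ) ^ M)⁻¹) atTop (𝓝 lam) := by
  rw [tendsto_iff_dist_tendsto_zero]
  have h2 : Tendsto (fun M : ℕ => ((2 : ℝ) ^ M)⁻¹ + ((2 : ℝ) ^ M)⁻¹) atTop (𝓝 0) := by
    simpa using tendsto_inv_two_pow.add tendsto_inv_two_pow
  refine squeeze_zero (fun _ => dist_nonneg) (fun M => ?_) h2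
  have hc : (floorCount M t lam : ℝ) = ⌊2 ^ M * (t + lam)⌋ - ⌊2 ^ M * t⌋ := by
    have : (floorCount M t lam : ℤ) = ⌊2 ^ M * (t + lam)⌋ - ⌊2 ^ M * t⌋ :=
      Int.toNat_of_nonneg (by linarith [floor_le_floor_add (M := M) t h0])
    exact_mod_cast this
  rw [Real.dist_eq, hc]
  have e : ((⌊2 ^ M * (t + lam)⌋ : ℝ) - ⌊2 ^ M * t⌋) * ((2 : ℝ) ^ M)⁻¹ - lam =
      ((⌊2 ^ M * (t + lam)⌋ : ℝ) / 2 ^ M - (t + lam)) - ((⌊2 ^ M * t⌋ : ℝ) / 2 ^ M - t) := by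
    rw [div_eq_mul_inv, div_eq_mul_inv]
    ring
  rw [e]
  exact (abs_sub _ _).trans (add_le_add (abs_floor_div_sub_le M _) (abs_floor_div_sub_le M _))

/-! ### Families of one-forms on all lattices -/

/-- A choice of values on the positive bonds of every lattice `Λ_M`. -/
abbrev LatticeFamily (d : ℕ) (E : Type*) : Type _ := ∀ M : ℕ, DyadicLattice d M → Fin d → E

namespace LatticeFamily

variable {d : ℕ} {E : Type*} [NormedAddCommGroup E]

/-- The member on `Λ_M` of a family, as a one-form. -/
noncomputable def form (x : LatticeFamily d E) (M : ℕ) : DiscreteOneForm d E M :=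
  DiscreteOneForm.ofVal (x M)

theorem form_val (x : LatticeFamily d E) (M : ℕ) : (x.form M).val = x M :=
  DiscreteOneForm.val_ofVal _

/-- The members of the family are restrictions of each other. -/
def IsConsistent (x : LatticeFamily d E) : Prop :=
  ∀ M N, M ≤ N → x M = ((x.form N).restrict M).val

theorem IsConsistent.form_eq {x : LatticeFamily d E} (hx : x.IsConsistent) {M N : ℕ} (h : M ≤ N) :
    x.form M = (x.form N).restrict M := by
  rw [form, hx M N h, DiscreteOneForm.ofVal_val]

/-- The supremum over all lattices of the growth norms. -/
noncomputable def growth (α : ℝ) (x : LatticeFamily d E) : ℝ≥0∞ :=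
  ⨆ M, growthENorm α (latticeSegments d M) (x.form M).onSegments

/-- The supremum over all lattices of the `ρ`-norms. -/
noncomputable def rhoNorm (α : ℝ) (x : LatticeFamily d E) : ℝ≥0∞ :=
  ⨆ M, rhoENorm α (latticeSegments d M) (x.form M).onSegments

/-- The supremum over all lattices of the lattice norms. -/
noncomputable def totalNorm (α : ℝ) (x : LatticeFamily d E) : ℝ≥0∞ :=
  ⨆ M, segmentENorm α (latticeSegments d M) (x.form M).onSegments

theorem IsConsistent.growth_add_rhoNorm {x : LatticeFamily d E} (hx : x.IsConsistent) (α : ℝ) :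
    x.growth α + x.rhoNorm α = x.totalNorm α := by
  refine ENNReal.iSup_add_iSup_of_monotone (fun M N h => ?_) (fun M N h => ?_)
  · rw [hx.form_eq h]
    exact DiscreteOneForm.growthENorm_restrict_le α h _
  · rw [hx.form_eq h]
    exact DiscreteOneForm.rhoENorm_restrict_le α h _

/-- The sum of the values over the bonds `(y + (i - y_μ) e_μ, μ)` with `i` in `s`. -/
def lineSum (x : LatticeFamily d E) (M : ℕ) (y : DyadicLattice d M) (μ : Fin d)
    (s : Finset ℤ) : E :=
  ∑ i ∈ s, x M (y.setCoord μ (i : ZMod (2 ^ M))) μ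

/-- The sum of the values over the bonds of the lattice line through `y` in direction `μ` whose
base points project into `T`. -/
noncomputable def arcSum (x : LatticeFamily d E) (M : ℕ) (y : DyadicLattice d M) (μ : Fin d)
    (T : Set UnitAddCircle) : E :=
  ∑ j ∈ latticePoints M T, x M (y.setCoord μ j) μ

/-- The value of the family on a segment of `𝒳^{(M)}` close to the segment
`{p + c e_μ | c ∈ [0, lam]}`. -/
noncomputable def approx (x : LatticeFamily d E) (M : ℕ) (p : Torus d) (μ : Fin d) (lam : ℝ) : E :=
  x.lineSum M (floorPoint M p) μ (floorInterval M (circleLift (p μ)) lam)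

theorem lineSum_Ico (x : LatticeFamily d E) (M : ℕ) (y : DyadicLattice d M) (μ : Fin d) (a b : ℤ) :
    x.lineSum M y μ (Finset.Ico a b) = ∑ i ∈ Finset.range (b - a).toNat,
      (x.form M).val ((y.setCoord μ (a : ZMod (2 ^ M))).step μ i) μ := by
  have hI : Finset.Ico a b = (Finset.range (b - a).toNat).image fun i : ℕ => a + (i : ℤ) := by
    ext i
    simp only [Finset.mem_Ico, Finset.mem_image, Finset.mem_range]
    constructor
    · intro h
      exact ⟨(i - a).toNat, by omega, by omega⟩
    · rintro ⟨j, hj, rfl⟩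
      omega
  rw [lineSum, hI, Finset.sum_image (fun i _ j _ h => by simpa using h), form_val]
  refine Finset.sum_congr rfl fun i _ => ?_
  congr 1
  funext κ
  by_cases hκ : κ = μ
  · subst hκ
    rw [DyadicLattice.step_apply_self, DyadicLattice.setCoord_apply_self,
      DyadicLattice.setCoord_apply_self]
    simp
  · rw [DyadicLattice.step_apply_of_ne _ hκ, DyadicLattice.setCoord_apply_of_ne _ hκ,
      DyadicLattice.setCoord_apply_of_ne _ hκ]

theorem approx_eq_sum_range (x : LatticeFamily d E) (M : ℕ) (p : Torus d) (μ : Fin d) (lam : ℝ) :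
    x.approx M p μ lam = ∑ i ∈ Finset.range (floorCount M (circleLift (p μ)) lam),
      (x.form M).val ((floorPoint M p).step μ i) μ := by
  rw [approx, floorInterval, lineSum_Ico]
  have : (floorPoint M p).setCoord μ ((⌊2 ^ M * circleLift (p μ)⌋ : ℤ) : ZMod (2 ^ M)) =
      floorPoint M p := by
    rw [DyadicLattice.setCoord, Function.update_eq_self_iff]
    rfl
  rw [this]
  rfl

theorem norm_approx_le {x : LatticeFamily d E} {α g : ℝ} (hg : 0 ≤ g)
    (hx : x.growth α ≤ ENNReal.ofReal g) (M : ℕ) (p : Torus d) (μ : Fin d) {lam : ℝ}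
    (h1 : lam ≤ 1) :
    ‖x.approx M p μ lam‖ ≤ g * (floorCount M (circleLift (p μ)) lam * ((2 : ℝ) ^ M)⁻¹) ^ α := by
  rw [approx_eq_sum_range]
  exact DiscreteOneForm.norm_sum_range_le hg ((le_iSup _ M).trans hx) _ _ (floorCount_le _ h1)

theorem norm_approx_sub_le {x : LatticeFamily d E} {α r : ℝ} (hr : 0 ≤ r)
    (hx : x.rhoNorm α ≤ ENNReal.ofReal r) (M : ℕ) {p p' : Torus d} {μ : Fin d} (hp : p μ = p' μ)
    {lam : ℝ} (h1 : lam ≤ 1) :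
    ‖x.approx M p μ lam - x.approx M p' μ lam‖ ≤
      r * (√(floorCount M (circleLift (p μ)) lam * ((2 : ℝ) ^ M)⁻¹) *
        √(dist (floorPoint M p).toTorus (floorPoint M p').toTorus)) ^ α := by
  rw [approx_eq_sum_range, approx_eq_sum_range, ← hp]
  refine DiscreteOneForm.norm_sum_range_sub_le hr ((le_iSup _ M).trans hx) ?_
    (floorCount_le _ h1)
  simp only [floorPoint, hp]

theorem norm_apply_le {x : LatticeFamily d E} {α g : ℝ} (hg : 0 ≤ g)
    (hx : x.growth α ≤ ENNReal.ofReal g) (M : ℕ) (y : DyadicLattice d M) (μ : Fin d) :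
    ‖x M y μ‖ ≤ g * (((2 : ℝ) ^ M)⁻¹) ^ α := by
  have := DiscreteOneForm.norm_sum_range_le hg ((le_iSup _ M).trans hx) y μ (k := 1)
    Nat.one_le_two_pow
  simpa [form_val, DyadicLattice.step_zero] using this

theorem norm_sum_sub_sum_le {ι : Type*} [DecidableEq ι] {f : ι → E} {δ : ℝ} (hf : ∀ i, ‖f i‖ ≤ δ)
    (s t : Finset ι) :
    ‖∑ i ∈ s, f i - ∑ i ∈ t, f i‖ ≤ ((s \ t).card + (t \ s).card : ℕ) * δ := by
  have e : ∑ i ∈ s, f i - ∑ i ∈ t, f i = ∑ i ∈ s \ t, f i - ∑ i ∈ t \ s, f i := by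
    rw [← Finset.sum_sdiff_sub_sum_sdiff]
  rw [e]
  have h : ∀ u : Finset ι, ‖∑ i ∈ u, f i‖ ≤ u.card * δ := fun u =>
    (norm_sum_le_of_le u fun i _ => hf i).trans (by simp)
  refine (norm_sub_le _ _).trans ((add_le_add (h _) (h _)).trans ?_)
  push_cast
  rw [add_mul]

/-- The parametrized and the set-based lattice approximations of a segment differ by at most two
bonds. -/
theorem norm_approx_sub_arcSum_le {x : LatticeFamily d E} {α g : ℝ} (hg : 0 ≤ g)
    (hx : x.growth α ≤ ENNReal.ofReal g) (M : ℕ) (p : Torus d) (μ : Fin d) {lam : ℝ}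
    (h1 : lam ≤ 1) :
    ‖x.approx M p μ lam - x.arcSum M (floorPoint M p) μ (circleArc (p μ) lam)‖ ≤
      2 * (g * (((2 : ℝ) ^ M)⁻¹) ^ α) := by
  classical
  set t := circleLift (p μ) with ht
  have hs := norm_sum_sub_sum_le (f := fun j : ZMod (2 ^ M) =>
      x M ((floorPoint M p).setCoord μ j) μ)
    (fun j => norm_apply_le hg hx M _ μ)
    ((floorInterval M t lam).image fun i : ℤ => (i : ZMod (2 ^ M)))
    (latticePoints M (circleArc t lam))
  rw [Finset.sum_image (intCast_injOn_floorInterval h1)] at hs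
  have c1 := (Finset.card_le_card (image_floorInterval_sdiff (M := M) t lam)).trans
    (Finset.card_singleton _).le
  have c2 := (Finset.card_le_card (latticePoints_sdiff (M := M) t lam)).trans
    (Finset.card_singleton _).le
  rw [ht, coe_circleLift, ← ht] at hs c1 c2
  refine hs.trans (mul_le_mul_of_nonneg_right ?_ (by positivity))
  exact_mod_cast add_le_add c1 c2

/-! ### Comparison of successive lattice approximations -/

theorem refine_update_step {M : ℕ} (y : DyadicLattice d M) (μ : Fin d) (i : ℤ) (k : ℕ) :
    ((y.setCoord μ (i : ZMod (2 ^ M))).refine (M + 1)).step μ k =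
      (y.refine (M + 1)).setCoord μ ((2 * i + k : ℤ) : ZMod (2 ^ (M + 1))) := by
  funext κ
  by_cases hκ : κ = μ
  · subst hκ
    rw [DyadicLattice.step_apply_self, DyadicLattice.setCoord_apply_self, DyadicLattice.refine,
      DyadicLattice.setCoord_apply_self, Nat.add_sub_cancel_left, pow_one]
    have h1 : (((i : ZMod (2 ^ M)).val : ℕ) : ℤ) = i % ((2 ^ M : ℕ) : ℤ) := ZMod.val_intCast i
    have h2 := Int.emod_add_mul_ediv i ((2 ^ M : ℕ) : ℤ)
    have h3 : (2 * i : ℤ) = ((i : ZMod (2 ^ M)).val : ℕ) * 2 +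
        ((2 ^ (M + 1) : ℕ) : ℤ) * (i / ((2 ^ M : ℕ) : ℤ)) := by
      rw [h1]
      push_cast at h2 ⊢
      rw [pow_succ]
      linarith
    rw [Int.cast_add, h3, Int.cast_add, Int.cast_mul ((2 ^ (M + 1) : ℕ) : ℤ), Int.cast_natCast,
      ZMod.natCast_self]
    push_cast
    ring
  · rw [DyadicLattice.step_apply_of_ne _ hκ, DyadicLattice.setCoord_apply_of_ne _ hκ,
      DyadicLattice.refine,
      DyadicLattice.refine, DyadicLattice.setCoord_apply_of_ne _ hκ]

theorem sum_Ico_two_mul (f : ℤ → E) {a b : ℤ} (h : a ≤ b) :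
    ∑ i ∈ Finset.Ico a b, (f (2 * i) + f (2 * i + 1)) = ∑ i ∈ Finset.Ico (2 * a) (2 * b), f i := by
  induction b, h using Int.leInduction with
  | base => simp
  | succ b hb ih =>
    have e1 : Finset.Ico a (b + 1) = insert b (Finset.Ico a b) := by
      ext i; simp only [Finset.mem_insert, Finset.mem_Ico]; omega
    have e2 : Finset.Ico (2 * a) (2 * (b + 1)) =
        insert (2 * b) (insert (2 * b + 1) (Finset.Ico (2 * a) (2 * b))) := by
      ext i; simp only [Finset.mem_insert, Finset.mem_Ico]; omega
    rw [e1, e2, Finset.sum_insert (by simp), Finset.sum_insert (by simp),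
      Finset.sum_insert (by simp), ih, add_assoc]

theorem IsConsistent.lineSum_eq {x : LatticeFamily d E} (hx : x.IsConsistent) (M : ℕ)
    (y : DyadicLattice d M) (μ : Fin d) {a b : ℤ} (h : a ≤ b) :
    x.lineSum M y μ (Finset.Ico a b) =
      x.lineSum (M + 1) (y.refine (M + 1)) μ (Finset.Ico (2 * a) (2 * b)) := by
  rw [lineSum, lineSum, ← sum_Ico_two_mul _ h]
  refine Finset.sum_congr rfl fun i _ => ?_
  rw [hx M (M + 1) (Nat.le_succ M), DiscreteOneForm.restrict_val, Nat.add_sub_cancel_left, pow_one,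
    Finset.sum_range_succ, Finset.sum_range_one, form_val, refine_update_step, refine_update_step]
  simp

theorem floor_two_mul (s : ℝ) : ⌊2 * s⌋ = 2 * ⌊s⌋ ∨ ⌊2 * s⌋ = 2 * ⌊s⌋ + 1 := by
  have h1 : 2 * ⌊s⌋ ≤ ⌊2 * s⌋ := by
    rw [Int.le_floor]
    push_cast
    linarith [Int.floor_le s]
  have h2 : ⌊2 * s⌋ < 2 * ⌊s⌋ + 2 := by
    rw [Int.floor_lt]
    push_cast
    linarith [Int.lt_floor_add_one s]
  omega

theorem dist_toTorus_update_le {M : ℕ} (p : Torus d) (μ : Fin d) (j : ZMod (2 ^ (M + 1))) :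
    dist (((floorPoint M p).refine (M + 1)).setCoord μ j).toTorus
      ((floorPoint (M + 1) p).setCoord μ j).toTorus ≤ d * (2 * (2 ^ M)⁻¹) := by
  refine torus_dist_le (by positivity) fun κ => ?_
  by_cases hκ : κ = μ
  · subst hκ
    rw [DyadicLattice.toTorus_apply, DyadicLattice.toTorus_apply, DyadicLattice.setCoord_apply_self,
      DyadicLattice.setCoord_apply_self, dist_self]
    positivity
  · rw [DyadicLattice.toTorus_apply, DyadicLattice.toTorus_apply,
      DyadicLattice.setCoord_apply_of_ne _ hκ, DyadicLattice.setCoord_apply_of_ne _ hκ,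
      ← DyadicLattice.toTorus_apply, ← DyadicLattice.toTorus_apply,
      DyadicLattice.toTorus_refine (Nat.le_succ M)]
    have h1 := dist_toTorus_floorPoint_apply_le M p κ
    have h2 := dist_toTorus_floorPoint_apply_le (M + 1) p κ
    have h3 : ((2 : ℝ) ^ (M + 1))⁻¹ ≤ (2 ^ M)⁻¹ :=
      inv_anti₀ (by positivity) (pow_le_pow_right₀ one_le_two (Nat.le_succ M))
    rw [dist_comm] at h2
    linarith [dist_triangle ((floorPoint M p).toTorus κ) (p κ) ((floorPoint (M + 1) p).toTorus κ)]

theorem norm_approx_succ_sub_le {x : LatticeFamily d E} (hx : x.IsConsistent) {α K : ℝ}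
    (hα : 0 ≤ α) (hK : 0 ≤ K)
    (hg : x.growth α ≤ ENNReal.ofReal K) (hr : x.rhoNorm α ≤ ENNReal.ofReal K) (M : ℕ)
    (p : Torus d) (μ : Fin d) {lam : ℝ} (h0 : 0 ≤ lam) (h1 : lam ≤ 1) :
    ‖x.approx M p μ lam - x.approx (M + 1) p μ lam‖ ≤
      K * ((2 * d : ℝ) ^ (α / 2) + 2) * ((2 : ℝ)⁻¹ ^ (α / 2)) ^ M := by
  set t := circleLift (p μ)
  set a := ⌊2 ^ M * t⌋
  set b := ⌊2 ^ M * (t + lam)⌋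
  have hab : a ≤ b := floor_le_floor_add t h0
  have hab' : b ≤ a + 2 ^ M := floor_add_le_floor t h1
  have e0 : x.approx M p μ lam =
      x.lineSum (M + 1) ((floorPoint M p).refine (M + 1)) μ (Finset.Ico (2 * a) (2 * b)) :=
    hx.lineSum_eq M _ μ hab
  set m := x.lineSum (M + 1) (floorPoint (M + 1) p) μ (Finset.Ico (2 * a) (2 * b))
  have hq : (((2 : ℝ) ^ M)⁻¹) ^ (α / 2) = ((2 : ℝ)⁻¹ ^ (α / 2)) ^ M := by
    rw [← inv_pow, ← Real.rpow_natCast, ← Real.rpow_natCast, ← Real.rpow_mul (by norm_num),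
      ← Real.rpow_mul (by norm_num), mul_comm]
  -- move the line of bonds in the transversal directions
  have s1 : ‖x.approx M p μ lam - m‖ ≤ K * (2 * d : ℝ) ^ (α / 2) * ((2 : ℝ)⁻¹ ^ (α / 2)) ^ M := by
    rw [e0, lineSum_Ico, show m = _ from lineSum_Ico ..]
    have hn : (2 * b - 2 * a).toNat ≤ 2 ^ (M + 1) := by
      rw [Int.toNat_le]
      push_cast
      rw [pow_succ]
      linarith
    refine (DiscreteOneForm.norm_sum_range_sub_le hK ((le_iSup _ (M + 1)).trans hr)
      (by rw [DyadicLattice.setCoord_apply_self, DyadicLattice.setCoord_apply_self]) hn).trans ?_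
    rw [mul_assoc, ← hq, ← Real.mul_rpow (by positivity) (by positivity)]
    refine mul_le_mul_of_nonneg_left ?_ hK
    have hle : √((2 * b - 2 * a).toNat * ((2 : ℝ) ^ (M + 1))⁻¹) ≤ 1 := by
      rw [Real.sqrt_le_one, ← div_eq_mul_inv, div_le_one (by positivity)]
      exact_mod_cast hn
    have hle2 := Real.sqrt_le_sqrt (dist_toTorus_update_le (M := M) p μ ((2 * a : ℤ) : ZMod _))
    calc _ ≤ (1 * √(d * (2 * (2 ^ M)⁻¹))) ^ α :=
          Real.rpow_le_rpow (by positivity)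
            (mul_le_mul hle hle2 (Real.sqrt_nonneg _) zero_le_one) hα
      _ = (2 * d * (2 ^ M)⁻¹ : ℝ) ^ (α / 2) := by
          rw [one_mul, Real.sqrt_eq_rpow, ← Real.rpow_mul (by positivity)]
          congr 1 <;> ring
  -- adjust the two end points
  have s2 : ‖m - x.approx (M + 1) p μ lam‖ ≤ K * 2 * ((2 : ℝ)⁻¹ ^ (α / 2)) ^ M := by
    have hd := norm_sum_sub_sum_le
      (f := fun i : ℤ => x (M + 1) ((floorPoint (M + 1) p).setCoord μ
        (i : ZMod (2 ^ (M + 1)))) μ)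
      (fun j => norm_apply_le hK hg (M + 1) _ μ) (Finset.Ico (2 * a) (2 * b))
      (floorInterval (M + 1) t lam)
    have ea : ⌊2 ^ (M + 1) * t⌋ = 2 * a ∨ ⌊2 ^ (M + 1) * t⌋ = 2 * a + 1 := by
      rw [pow_succ, mul_comm _ (2 : ℝ), mul_assoc]
      exact floor_two_mul _
    have eb : ⌊2 ^ (M + 1) * (t + lam)⌋ = 2 * b ∨ ⌊2 ^ (M + 1) * (t + lam)⌋ = 2 * b + 1 := by
      rw [pow_succ, mul_comm _ (2 : ℝ), mul_assoc]
      exact floor_two_mul _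
    have c1 : Finset.Ico (2 * a) (2 * b) \ floorInterval (M + 1) t lam ⊆ {2 * a} := by
      intro i
      simp only [floorInterval, Finset.mem_sdiff, Finset.mem_Ico, Finset.mem_singleton]
      omega
    have c2 : floorInterval (M + 1) t lam \ Finset.Ico (2 * a) (2 * b) ⊆ {2 * b} := by
      intro i
      simp only [floorInterval, Finset.mem_sdiff, Finset.mem_Ico, Finset.mem_singleton]
      omega
    have c3 := add_le_add (Finset.card_le_card c1) (Finset.card_le_card c2)
    rw [Finset.card_singleton, Finset.card_singleton] at c3
    refine le_trans hd ?_
    have hpow : (((2 : ℝ) ^ (M + 1))⁻¹) ^ α ≤ ((2 : ℝ)⁻¹ ^ (α / 2)) ^ M := by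
      rw [← hq]
      calc (((2 : ℝ) ^ (M + 1))⁻¹) ^ α ≤ (((2 : ℝ) ^ M)⁻¹) ^ α :=
            Real.rpow_le_rpow (by positivity)
              (inv_anti₀ (by positivity) (pow_le_pow_right₀ one_le_two (Nat.le_succ M))) hα
        _ ≤ (((2 : ℝ) ^ M)⁻¹) ^ (α / 2) :=
            Real.rpow_le_rpow_of_exponent_ge (by positivity)
              (inv_le_one_of_one_le₀ (one_le_pow₀ one_le_two)) (by linarith)
    calc _ ≤ (2 : ℝ) * (K * ((2 : ℝ)⁻¹ ^ (α / 2)) ^ M) := by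
          refine mul_le_mul (by exact_mod_cast c3) (mul_le_mul_of_nonneg_left hpow hK)
            (by positivity) (by norm_num)
      _ = _ := by ring
  calc _ = ‖(x.approx M p μ lam - m) + (m - x.approx (M + 1) p μ lam)‖ := by
        rw [sub_add_sub_cancel]
    _ ≤ _ := (norm_add_le _ _).trans (add_le_add s1 s2)
    _ = _ := by ring

end LatticeFamily

/-! ### Extension of a lattice family to all segments -/

namespace LatticeFamily

variable {d : ℕ} {E : Type*} [NormedAddCommGroup E]

theorem arcSum_congr (x : LatticeFamily d E) (M : ℕ) {y y' : DyadicLattice d M} {μ : Fin d}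
    (h : ∀ ν, ν ≠ μ → y ν = y' ν) (T : Set UnitAddCircle) :
    x.arcSum M y μ T = x.arcSum M y' μ T := by
  refine Finset.sum_congr rfl fun j _ => ?_
  congr 1
  funext ν
  by_cases hν : ν = μ
  · subst hν
    rw [DyadicLattice.setCoord_apply_self, DyadicLattice.setCoord_apply_self]
  · rw [DyadicLattice.setCoord_apply_of_ne _ hν, DyadicLattice.setCoord_apply_of_ne _ hν, h ν hν]

theorem arcSum_floorPoint_congr (x : LatticeFamily d E) (M : ℕ) {p p' : Torus d} {μ : Fin d}
    (h : ∀ ν, ν ≠ μ → p ν = p' ν) (T : Set UnitAddCircle) :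
    x.arcSum M (floorPoint M p) μ T = x.arcSum M (floorPoint M p') μ T :=
  x.arcSum_congr M (fun ν hν => by simp only [floorPoint, h ν hν]) T

/-- The growth and `ρ`-bounds by `K` that make the lattice approximations converge. -/
structure IsBounded (α K : ℝ) (x : LatticeFamily d E) : Prop where
  consistent : x.IsConsistent
  nonneg : 0 ≤ K
  growth_le : x.growth α ≤ ENNReal.ofReal K
  rho_le : x.rhoNorm α ≤ ENNReal.ofReal K

open Classical in
/-- The extension of a lattice family to all segments: the limit of the lattice approximations. The
representation of the segment used here does not matter by `tendsto_approx`. -/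
noncomputable def extend (x : LatticeFamily d E) (ℓ : AxisSegment d) : E :=
  if ℓ.length = 0 then 0 else
    limUnder atTop fun M => x.approx M ℓ.exists_carrier_eq.choose
      ℓ.exists_carrier_eq.choose_spec.choose ℓ.length

theorem tendsto_bond_size {α : ℝ} (hα : 0 < α) (C : ℝ) :
    Tendsto (fun M : ℕ => C * (((2 : ℝ) ^ M)⁻¹) ^ α) atTop (𝓝 0) := by
  have := (tendsto_inv_two_pow.rpow_const (p := α) (Or.inr hα.le)).const_mul C
  rwa [Real.zero_rpow hα.ne', mul_zero] at this

theorem ratio_lt_one {α : ℝ} (hα : 0 < α) : (2 : ℝ)⁻¹ ^ (α / 2) < 1 :=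
  Real.rpow_lt_one (by norm_num) (by norm_num) (by linarith)

section Limit

variable {α K : ℝ} {x : LatticeFamily d E}

theorem IsBounded.dist_approx_le (hx : x.IsBounded α K) (hα : 0 < α) (p : Torus d) (μ : Fin d)
    {lam : ℝ} (h0 : 0 ≤ lam) (h1 : lam ≤ 1) (M : ℕ) :
    dist (x.approx M p μ lam) (x.approx (M + 1) p μ lam) ≤
      K * ((2 * d : ℝ) ^ (α / 2) + 2) * ((2 : ℝ)⁻¹ ^ (α / 2)) ^ M := by
  rw [dist_eq_norm]
  exact norm_approx_succ_sub_le hx.consistent hα.le hx.nonneg hx.growth_le hx.rho_le M p μ h0 h1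

theorem IsBounded.tendsto_approx_sub_arcSum (hx : x.IsBounded α K) (hα : 0 < α) (p : Torus d)
    (μ : Fin d) {lam : ℝ} (h1 : lam ≤ 1) :
    Tendsto (fun M => x.approx M p μ lam - x.arcSum M (floorPoint M p) μ (circleArc (p μ) lam))
      atTop (𝓝 0) := by
  refine squeeze_zero_norm (fun M => norm_approx_sub_arcSum_le hx.nonneg hx.growth_le M p μ h1) ?_
  simpa [mul_assoc] using tendsto_bond_size hα (2 * K)

/-- The limit of the approximations is independent of the parametrization of the segment, since it
agrees with the limit of the sums over the bonds starting in the segment. -/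
theorem IsBounded.tendsto_approx [CompleteSpace E] (hx : x.IsBounded α K) (hα : 0 < α)
    {ℓ : AxisSegment d}
    {p : Torus d} {μ : Fin d} (h0 : 0 < ℓ.length) (h : ℓ.carrier = segmentSet p μ ℓ.length) :
    Tendsto (fun M => x.approx M p μ ℓ.length) atTop (𝓝 (x.extend ℓ)) := by
  set q := ℓ.exists_carrier_eq.choose
  set ν := ℓ.exists_carrier_eq.choose_spec.choose
  have hq : ℓ.carrier = segmentSet q ν ℓ.length := ℓ.exists_carrier_eq.choose_spec.choose_spec
  have hlim : Tendsto (fun M => x.approx M q ν ℓ.length) atTop (𝓝 (x.extend ℓ)) := by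
    rw [extend, if_neg h0.ne']
    exact (cauchySeq_of_le_geometric _ _ (ratio_lt_one hα)
      (hx.dist_approx_le hα q ν h0.le ℓ.length_le_one)).tendsto_limUnder
  have he : segmentSet p μ ℓ.length = segmentSet q ν ℓ.length := h.symm.trans hq
  obtain ⟨hμν, hpq⟩ := segmentSet_subset_imp h0 he.subset
  rw [← hμν] at hlim he
  have harc := congrArg (fun s => (fun r : Torus d => r μ) '' s) he
  simp only [image_coord_segmentSet] at harc
  have h1 := hx.tendsto_approx_sub_arcSum hα p μ ℓ.length_le_one
  have h2 := hx.tendsto_approx_sub_arcSum hα q μ ℓ.length_le_one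
  have h3 := (h1.sub h2).add hlim
  rw [sub_zero, zero_add] at h3
  refine h3.congr fun M => ?_
  rw [x.arcSum_floorPoint_congr M hpq, harc]
  abel

theorem IsBounded.dist_approx_extend_le [CompleteSpace E] (hx : x.IsBounded α K) (hα : 0 < α)
    {ℓ : AxisSegment d}
    {p : Torus d} {μ : Fin d} (h0 : 0 < ℓ.length) (h : ℓ.carrier = segmentSet p μ ℓ.length)
    (M : ℕ) :
    dist (x.approx M p μ ℓ.length) (x.extend ℓ) ≤
      K * ((2 * d : ℝ) ^ (α / 2) + 2) * ((2 : ℝ)⁻¹ ^ (α / 2)) ^ M / (1 - (2 : ℝ)⁻¹ ^ (α / 2)) :=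
  dist_le_of_le_geometric_of_tendsto _ _ (ratio_lt_one hα)
    (hx.dist_approx_le hα p μ h0.le ℓ.length_le_one) (hx.tendsto_approx hα h0 h) M

theorem norm_sum_latticePoints_le (hx : x.IsBounded α K) (M : ℕ) (y : DyadicLattice d M)
    (μ : Fin d) (s : Finset (ZMod (2 ^ M))) :
    ‖∑ j ∈ s, x M (y.setCoord μ j) μ‖ ≤ s.card * (K * (((2 : ℝ) ^ M)⁻¹) ^ α) :=
  (norm_sum_le_of_le s fun j _ => norm_apply_le hx.nonneg hx.growth_le M (y.setCoord μ j) μ).trans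
    (by simp)

/-- A segment contained in a segment of positive length can be approximated along the lattice lines
used for the latter. -/
theorem IsBounded.tendsto_arcSum [CompleteSpace E] (hx : x.IsBounded α K) (hα : 0 < α)
    {ℓ : AxisSegment d}
    {p : Torus d} {μ : Fin d} {lam : ℝ} (h : ℓ.carrier ⊆ segmentSet p μ lam) :
    ∃ a : UnitAddCircle, (fun q : Torus d => q μ) '' ℓ.carrier = circleArc a ℓ.length ∧
      Tendsto (fun M => x.arcSum M (floorPoint M p) μ (circleArc a ℓ.length)) atTop
        (𝓝 (x.extend ℓ)) := by
  obtain ⟨q, ν, hq⟩ := ℓ.exists_carrier_eq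
  rcases ℓ.length_nonneg.eq_or_lt with h0 | h0
  · refine ⟨q μ, ?_, ?_⟩
    · rw [hq, ← h0]
      simp [segmentSet, circleArc, Torus.shift_zero]
    · rw [extend, if_pos h0.symm, ← h0]
      refine squeeze_zero_norm (fun M => ?_) (tendsto_bond_size hα (2 * K))
      refine (norm_sum_latticePoints_le hx M _ μ _).trans ?_
      have hc := (abs_le.1 (abs_card_latticePoints_sub_le (M := M) (q μ) le_rfl zero_le_one)).2
      rw [mul_zero, sub_zero] at hc
      rw [mul_assoc]
      exact mul_le_mul_of_nonneg_right hc
        (mul_nonneg hx.nonneg (Real.rpow_nonneg (by positivity) _))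
  · rw [hq] at h
    obtain ⟨rfl, hqp⟩ := segmentSet_subset_imp h0 h
    refine ⟨q ν, by rw [← image_coord_segmentSet, ← hq], ?_⟩
    have h1 := hx.tendsto_approx_sub_arcSum hα q ν ℓ.length_le_one
    have h2 := (hx.tendsto_approx hα h0 hq).sub h1
    rw [sub_zero] at h2
    refine h2.congr fun M => ?_
    rw [x.arcSum_floorPoint_congr M hqp]
    abel

/-- The extension is additive: if `|ℓ ∪ ℓ'| = |ℓ| + |ℓ'|`, then by counting `ℓ ∩ ℓ'` contains a
bounded number of lattice points, whose contribution vanishes in the limit. -/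
theorem IsBounded.additive_extend [CompleteSpace E] (hx : x.IsBounded α K) (hα : 0 < α) :
    AdditiveOnSegments x.extend := by
  classical
  rintro ℓ ℓ' ℓ'' ⟨hU, hL⟩
  rcases ℓ''.length_nonneg.eq_or_lt with h0 | h0
  · have h1 : ℓ.length = 0 := by linarith [ℓ.length_nonneg, ℓ'.length_nonneg]
    have h2 : ℓ'.length = 0 := by linarith [ℓ.length_nonneg, ℓ'.length_nonneg]
    rw [extend, extend, extend, if_pos h0.symm, if_pos h1, if_pos h2, add_zero]
  obtain ⟨p, μ, hp⟩ := ℓ''.exists_carrier_eq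
  obtain ⟨a, ha, hta⟩ := hx.tendsto_arcSum hα (ℓ := ℓ) (p := p) (μ := μ) (lam := ℓ''.length)
    (by rw [← hp, hU]; exact Set.subset_union_left)
  obtain ⟨b, hb, htb⟩ := hx.tendsto_arcSum hα (ℓ := ℓ') (p := p) (μ := μ) (lam := ℓ''.length)
    (by rw [← hp, hU]; exact Set.subset_union_right)
  obtain ⟨c, hc, htc⟩ := hx.tendsto_arcSum hα (ℓ := ℓ'') (p := p) (μ := μ) (lam := ℓ''.length)
    hp.subset
  have hT : circleArc c ℓ''.length = circleArc a ℓ.length ∪ circleArc b ℓ'.length := by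
    rw [← ha, ← hb, ← hc, hU, Set.image_union]
  refine tendsto_nhds_unique htc ?_
  have hsum := hta.add htb
  suffices hz : Tendsto (fun M => x.arcSum M (floorPoint M p) μ (circleArc c ℓ''.length) -
      (x.arcSum M (floorPoint M p) μ (circleArc a ℓ.length) +
        x.arcSum M (floorPoint M p) μ (circleArc b ℓ'.length))) atTop (𝓝 0) by
    have := hz.add hsum
    rw [zero_add] at this
    exact this.congr fun M => sub_add_cancel _ _
  refine squeeze_zero_norm (fun M => ?_) (tendsto_bond_size hα (6 * K))
  set J := latticePoints M (circleArc a ℓ.length)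
  set J' := latticePoints M (circleArc b ℓ'.length)
  have hJ : latticePoints M (circleArc c ℓ''.length) = J ∪ J' := by
    ext j
    rw [Finset.mem_union, mem_latticePoints, mem_latticePoints, mem_latticePoints, hT,
      Set.mem_union]
  have e := Finset.sum_union_inter (s₁ := J) (s₂ := J')
    (f := fun j => x M ((floorPoint M p).setCoord μ j) μ)
  rw [arcSum, arcSum, arcSum, hJ, ← e, sub_add_cancel_left, norm_neg]
  refine (norm_sum_latticePoints_le hx M _ μ _).trans ?_
  rw [mul_assoc]
  refine mul_le_mul_of_nonneg_right ?_
    (mul_nonneg hx.nonneg (Real.rpow_nonneg (by positivity) _))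
  have c1 := abs_le.1 (abs_card_latticePoints_sub_le (M := M) a ℓ.length_nonneg ℓ.length_le_one)
  have c2 := abs_le.1 (abs_card_latticePoints_sub_le (M := M) b ℓ'.length_nonneg ℓ'.length_le_one)
  have c3 := abs_le.1
    (abs_card_latticePoints_sub_le (M := M) c ℓ''.length_nonneg ℓ''.length_le_one)
  rw [hJ, hL, mul_add] at c3
  have c4 : ((J ∪ J').card : ℝ) + (J ∩ J').card = J.card + J'.card := by
    exact_mod_cast Finset.card_union_add_card_inter J J'
  linarith [c1.2, c2.2, c3.1]

theorem IsBounded.norm_extend_le [CompleteSpace E] (hx : x.IsBounded α K) (hα : 0 < α)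
    {g : ℝ} (hg : 0 ≤ g)
    (hg' : x.growth α ≤ ENNReal.ofReal g) {ℓ : AxisSegment d} (h0 : 0 < ℓ.length) :
    ‖x.extend ℓ‖ ≤ g * ℓ.length ^ α := by
  obtain ⟨p, μ, hp⟩ := ℓ.exists_carrier_eq
  have h1 := ((tendsto_floorCount (circleLift (p μ)) h0.le).rpow_const (p := α)
    (Or.inr hα.le)).const_mul g
  exact le_of_tendsto_of_tendsto' (hx.tendsto_approx hα h0 hp).norm h1
    fun M => norm_approx_le hg hg' M p μ ℓ.length_le_one

theorem IsBounded.norm_extend_sub_le [CompleteSpace E] (hx : x.IsBounded α K) (hα : 0 < α)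
    {r : ℝ} (hr : 0 ≤ r)
    (hr' : x.rhoNorm α ≤ ENNReal.ofReal r) {ℓ ℓ' : AxisSegment d} (h : ℓ.Parallel ℓ') :
    ‖x.extend ℓ - x.extend ℓ'‖ ≤ r * ℓ.rho ℓ' ^ α := by
  obtain ⟨p, p', μ, hpp, h0, hp, hp'⟩ := h.exists_carrier_eq
  have hl : ℓ'.length = ℓ.length :=
    AxisSegment.length_of_carrier_eq h0.le ℓ.length_le_one hp'
  have ht := hx.tendsto_approx hα h0 hp
  have ht' := hx.tendsto_approx hα (hl ▸ h0) (by rw [hl]; exact hp')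
  rw [hl] at ht'
  have h1 : Tendsto (fun M => r * (√(floorCount M (circleLift (p μ)) ℓ.length * ((2 : ℝ) ^ M)⁻¹) *
      √(dist (floorPoint M p).toTorus (floorPoint M p').toTorus)) ^ α) atTop
      (𝓝 (r * (√ℓ.length * √(dist p p')) ^ α)) :=
    (((tendsto_floorCount (circleLift (p μ)) h0.le).sqrt.mul
      ((tendsto_toTorus_floorPoint p).dist (tendsto_toTorus_floorPoint p')).sqrt).rpow_const
      (Or.inr hα.le)).const_mul r
  refine (le_of_tendsto_of_tendsto' (ht.sub ht').norm h1 fun M =>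
    norm_approx_sub_le hr hr' M hpp ℓ.length_le_one).trans ?_
  refine mul_le_mul_of_nonneg_left (Real.rpow_le_rpow (by positivity) ?_ hα.le) hr
  exact mul_le_mul_of_nonneg_left (Real.sqrt_le_sqrt (AxisSegment.dist_le_infDist hpp hp hp'))
    (Real.sqrt_nonneg _)

theorem IsBounded.segmentENorm_extend_le [CompleteSpace E] (hx : x.IsBounded α K) (hα : 0 < α) :
    segmentENorm α Set.univ x.extend ≤ x.totalNorm α := by
  rw [← hx.consistent.growth_add_rhoNorm]
  have hg := (hx.growth_le.trans_lt ENNReal.ofReal_lt_top).ne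
  have hr := (hx.rho_le.trans_lt ENNReal.ofReal_lt_top).ne
  refine add_le_add ?_ ?_
  · refine iSup₂_le fun ℓ _ => iSup_le fun h0 => ?_
    rw [← ENNReal.ofReal_toReal hg]
    refine ENNReal.ofReal_le_ofReal ((div_le_iff₀ (Real.rpow_pos_of_pos h0 _)).2 ?_)
    exact hx.norm_extend_le hα ENNReal.toReal_nonneg (ENNReal.ofReal_toReal hg).ge h0
  · refine iSup₂_le fun ℓ _ => iSup₂_le fun ℓ' _ => iSup₂_le fun _ h => ?_
    rw [← ENNReal.ofReal_toReal hr]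
    refine ENNReal.ofReal_le_ofReal (div_le_of_le_mul₀ (Real.rpow_nonneg (ℓ.rho_nonneg ℓ') _)
      ENNReal.toReal_nonneg ?_)
    exact hx.norm_extend_sub_le hα ENNReal.toReal_nonneg (ENNReal.ofReal_toReal hr).ge h

/-- On a bond of `Λ_M` the approximations on all finer lattices are exact. -/
theorem IsConsistent.approx_segment (hx : x.IsConsistent) {M N : ℕ} (h : M ≤ N)
    (y : DyadicLattice d M) (μ : Fin d) :
    x.approx N y.toTorus μ ((2 : ℝ) ^ M)⁻¹ = x M y μ := by
  obtain ⟨k, rfl⟩ := Nat.exists_eq_add_of_le h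
  have hlift : ∀ ν, ∃ n : ℤ, 2 ^ (M + k) * circleLift (y.toTorus ν) =
      (((y ν).val * 2 ^ k - n * 2 ^ (M + k) : ℤ) : ℝ) := fun ν => by
    have h1 := coe_circleLift (y.toTorus ν)
    rw [DyadicLattice.toTorus_apply, ZMod.toAddCircle_apply, circle_coe_eq_coe_iff] at h1
    obtain ⟨n, hn⟩ := h1
    refine ⟨n, ?_⟩
    rw [DyadicLattice.toTorus_apply, ZMod.toAddCircle_apply, hn]
    push_cast
    generalize ((y ν).val : ℝ) = a
    rw [pow_add]
    field_simp
  have hfp : floorPoint (M + k) y.toTorus = y.refine (M + k) := by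
    funext ν
    obtain ⟨n, hn⟩ := hlift ν
    rw [floorPoint, hn, Int.floor_intCast, DyadicLattice.refine, Nat.add_sub_cancel_left]
    have e : ((2 : ZMod (2 ^ (M + k))) ^ (M + k)) = 0 := by
      have := ZMod.natCast_self (2 ^ (M + k))
      push_cast at this
      exact this
    push_cast
    rw [e]
    ring
  have hcount : floorCount (M + k) (circleLift (y.toTorus μ)) ((2 : ℝ) ^ M)⁻¹ = 2 ^ k := by
    obtain ⟨n, hn⟩ := hlift μ
    have e : (2 : ℝ) ^ (M + k) * ((2 : ℝ) ^ M)⁻¹ = ((2 ^ k : ℤ) : ℝ) := by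
      rw [pow_add]
      push_cast
      field_simp
    rw [floorCount, mul_add, hn, e, ← Int.cast_add, Int.floor_intCast, Int.floor_intCast,
      add_sub_cancel_left]
    norm_cast
  rw [approx_eq_sum_range, hcount, hfp, hx M (M + k) h, DiscreteOneForm.restrict_val,
    Nat.add_sub_cancel_left]

theorem IsBounded.extend_segment [CompleteSpace E] (hx : x.IsBounded α K) (hα : 0 < α) (M : ℕ)
    (y : DyadicLattice d M) (μ : Fin d) : x.extend (Bond.segment M y μ) = x M y μ := by
  have hl : (Bond.segment M y μ).length = ((2 : ℝ) ^ M)⁻¹ :=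
    AxisSegment.length_of_carrier_eq (by positivity)
      (inv_le_one_of_one_le₀ (one_le_pow₀ one_le_two)) (Bond.carrier_segment y μ)
  have ht := hx.tendsto_approx hα (ℓ := Bond.segment M y μ) (p := y.toTorus) (μ := μ)
    (by rw [hl]; positivity) (by rw [hl]; exact Bond.carrier_segment y μ)
  rw [hl] at ht
  refine tendsto_nhds_unique ht (tendsto_const_nhds.congr' ?_)
  filter_upwards [eventually_ge_atTop M] with N hN
  exact (hx.consistent.approx_segment hN y μ).symm

end Limit

end LatticeFamily

/-! ### Interpolation between the norms of `Ω_α` -/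

theorem AxisSegment.Parallel.rho_pos {d : ℕ} {ℓ ℓ' : AxisSegment d} (h : ℓ.Parallel ℓ')
    (hne : ℓ ≠ ℓ') : 0 < ℓ.rho ℓ' := by
  obtain ⟨p, p', μ, hpp, h0, hp, hp'⟩ := h.exists_carrier_eq
  have hpne : p ≠ p' := by
    rintro rfl
    exact hne (Subtype.ext (hp.trans hp'.symm))
  have hd : 0 < ℓ.infDist ℓ' :=
    (dist_pos.2 hpne).trans_le (AxisSegment.dist_le_infDist hpp hp hp')
  exact mul_pos (Real.sqrt_pos.2 h0) (Real.sqrt_pos.2 hd)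

theorem div_rpow_le_of_le_mul_rpow {a r K ε β α : ℝ} (ha : 0 ≤ a) (hr : 0 < r) (hK : 0 ≤ K)
    (hβ : 0 ≤ β) (hβα : β < α) (h1 : a ≤ K * r ^ α) (h2 : a ≤ ε) :
    a / r ^ β ≤ K ^ (β / α) * ε ^ (1 - β / α) := by
  have hα : 0 < α := hβ.trans_lt hβα
  have hθ : 0 ≤ β / α := div_nonneg hβ hα.le
  have hθ' : 0 ≤ 1 - β / α := by
    rw [sub_nonneg, div_le_one hα]
    exact hβα.le
  have hε : 0 ≤ ε := ha.trans h2
  rw [div_le_iff₀ (Real.rpow_pos_of_pos hr _)]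
  rcases ha.eq_or_lt with h0 | h0
  · rw [← h0]
    positivity
  calc a = a ^ (β / α) * a ^ (1 - β / α) := by
        rw [← Real.rpow_add h0, add_sub_cancel, Real.rpow_one]
    _ ≤ (K * r ^ α) ^ (β / α) * ε ^ (1 - β / α) :=
        mul_le_mul (Real.rpow_le_rpow ha h1 hθ) (Real.rpow_le_rpow ha h2 hθ')
          (Real.rpow_nonneg ha _) (Real.rpow_nonneg (ha.trans h1) _)
    _ = K ^ (β / α) * ε ^ (1 - β / α) * r ^ β := by
        rw [Real.mul_rpow hK (Real.rpow_nonneg hr.le _), ← Real.rpow_mul hr.le,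
          mul_div_cancel₀ _ hα.ne']
        ring

namespace Omega

variable {d : ℕ} {E : Type*} [NormedAddCommGroup E] [NormedSpace ℝ E] {α : ℝ}

/-- An additive function of finite norm as an element of `Ω_α`. -/
def ofAdditive (F : AxisSegment d → E) (h : AdditiveOnSegments F)
    (h' : segmentENorm α Set.univ F < ⊤) : Omega d E α :=
  ⟨F, h, h'⟩

theorem toFun_inclusion {β : ℝ} (hβ : 0 ≤ β) (hβα : β ≤ α) (D : Omega d E α) :
    (D.inclusion hβ hβα).toFun = D.toFun := by
  -- `rfl` on the folded terms would try to identify `D` with its image in another space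
  delta inclusion
  delta toFun
  exact Eq.refl (Subtype.val D)

theorem segmentENorm_toFun_lt_top (D : Omega d E α) : segmentENorm α Set.univ D.toFun < ⊤ :=
  D.2.2

theorem norm_toFun_le (D : Omega d E α) {ℓ : AxisSegment d} (h : 0 < ℓ.length) :
    ‖D.toFun ℓ‖ ≤ ‖D‖ * ℓ.length ^ α := by
  rw [← div_le_iff₀ (Real.rpow_pos_of_pos h _), norm_def]
  exact (ENNReal.ofReal_le_iff_le_toReal D.segmentENorm_toFun_lt_top.ne).1
    ((le_growthENorm α D.toFun (Set.mem_univ ℓ) h).trans le_self_add)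

theorem norm_toFun_sub_le (D : Omega d E α) {ℓ ℓ' : AxisSegment d} (hne : ℓ ≠ ℓ')
    (h : ℓ.Parallel ℓ') : ‖D.toFun ℓ - D.toFun ℓ'‖ ≤ ‖D‖ * ℓ.rho ℓ' ^ α := by
  rw [← div_le_iff₀ (Real.rpow_pos_of_pos (h.rho_pos hne) _), norm_def]
  exact (ENNReal.ofReal_le_iff_le_toReal D.segmentENorm_toFun_lt_top.ne).1
    ((le_rhoENorm α D.toFun (Set.mem_univ ℓ) (Set.mem_univ ℓ') hne h).trans le_add_self)

/-- On bounded subsets of `Ω_α` the norm `|·|_β` is controlled by the supremum norm. -/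
theorem norm_inclusion_le {β : ℝ} (hβ : 0 ≤ β) (hβα : β < α) (D : Omega d E α) {K ε : ℝ}
    (hK : ‖D‖ ≤ K) (hε0 : 0 ≤ ε) (hε : ∀ ℓ, ‖D.toFun ℓ‖ ≤ ε) :
    ‖D.inclusion hβ hβα.le‖ ≤ 2 * (K ^ (β / α) * (2 * ε) ^ (1 - β / α)) := by
  have hK0 : 0 ≤ K := (norm_nonneg D).trans hK
  have hB : 0 ≤ K ^ (β / α) * (2 * ε) ^ (1 - β / α) := by positivity
  rw [norm_def, toFun_inclusion]
  refine ENNReal.toReal_le_of_le_ofReal (by positivity) ?_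
  rw [two_mul, ENNReal.ofReal_add hB hB]
  refine add_le_add ?_ ?_
  · refine iSup₂_le fun ℓ _ => iSup_le fun h0 => ENNReal.ofReal_le_ofReal ?_
    refine div_rpow_le_of_le_mul_rpow (norm_nonneg _) h0 hK0 hβ hβα
      ((D.norm_toFun_le h0).trans (mul_le_mul_of_nonneg_right hK (Real.rpow_nonneg h0.le _))) ?_
    exact (hε ℓ).trans (by linarith)
  · refine iSup₂_le fun ℓ _ => iSup₂_le fun ℓ' _ => iSup₂_le fun hne h =>
      ENNReal.ofReal_le_ofReal ?_
    refine div_rpow_le_of_le_mul_rpow (norm_nonneg _) (h.rho_pos hne) hK0 hβ hβα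
      ((D.norm_toFun_sub_le hne h).trans
        (mul_le_mul_of_nonneg_right hK (Real.rpow_nonneg (ℓ.rho_nonneg ℓ') _))) ?_
    exact (norm_sub_le _ _).trans (by linarith [hε ℓ, hε ℓ'])

end Omega

/-! ### Semicontinuity of the lattice norms -/

namespace DiscreteOneForm

variable {d : ℕ} {E : Type*} [NormedAddCommGroup E] {M N : ℕ}

theorem continuous_val (x : DyadicLattice d N) (μ : Fin d) :
    Continuous fun A : DiscreteOneForm d E N => A.val x μ :=
  (continuous_apply (Bond.pos x μ)).comp continuous_subtype_val

theorem continuous_ofVal : Continuous (ofVal : (DyadicLattice d N → Fin d → E) → _) := by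
  refine Continuous.subtype_mk (continuous_pi fun b => ?_) _
  split_ifs
  · exact continuous_apply_apply b.base b.dir
  · exact (continuous_apply_apply b.endpoint b.dir).neg

theorem continuous_restrict : Continuous fun A : DiscreteOneForm d E N => A.restrict M := by
  refine continuous_ofVal.comp (continuous_pi fun x => continuous_pi fun μ => ?_)
  exact continuous_finsetSum _ fun k _ => continuous_val _ _

theorem continuous_onSegments (ℓ : AxisSegment d) :
    Continuous fun A : DiscreteOneForm d E N => A.onSegments ℓ := by
  refine continuous_finsetSum _ fun b _ => ?_
  split_ifs
  · exact continuous_val _ _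
  · exact continuous_const

theorem lowerSemicontinuous_segmentENorm (α : ℝ) (S : Set (AxisSegment d)) :
    LowerSemicontinuous fun A : DiscreteOneForm d E N => segmentENorm α S A.onSegments := by
  refine LowerSemicontinuous.add ?_ ?_
  · refine lowerSemicontinuous_iSup fun ℓ => lowerSemicontinuous_iSup fun _ =>
      lowerSemicontinuous_iSup fun _ => Continuous.lowerSemicontinuous ?_
    exact ENNReal.continuous_ofReal.comp ((continuous_onSegments ℓ).norm.div_const _)
  · refine lowerSemicontinuous_iSup fun ℓ => lowerSemicontinuous_iSup fun _ =>
      lowerSemicontinuous_iSup fun ℓ' => lowerSemicontinuous_iSup fun _ =>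
      lowerSemicontinuous_iSup fun _ => lowerSemicontinuous_iSup fun _ =>
      Continuous.lowerSemicontinuous ?_
    exact ENNReal.continuous_ofReal.comp
      (((continuous_onSegments ℓ).sub (continuous_onSegments ℓ')).norm.div_const _)

theorem measurable_latticeNorm (α : ℝ) :
    Measurable fun A : DiscreteOneForm d E N => A.latticeNorm α :=
  (lowerSemicontinuous_segmentENorm α _).measurable.ennreal_toReal

end DiscreteOneForm

namespace LatticeFamily

variable {d : ℕ} {E : Type*} [NormedAddCommGroup E]

theorem continuous_form (M : ℕ) : Continuous fun x : LatticeFamily d E => x.form M :=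
  DiscreteOneForm.continuous_ofVal.comp (continuous_apply M)

theorem lowerSemicontinuous_segmentENorm_form (α : ℝ) (M : ℕ) :
    LowerSemicontinuous fun x : LatticeFamily d E =>
      segmentENorm α (latticeSegments d M) (x.form M).onSegments :=
  LowerSemicontinuous.comp (DiscreteOneForm.lowerSemicontinuous_segmentENorm α _)
    (continuous_form M)

theorem lowerSemicontinuous_totalNorm (α : ℝ) :
    LowerSemicontinuous fun x : LatticeFamily d E => x.totalNorm α :=
  lowerSemicontinuous_iSup fun M => lowerSemicontinuous_segmentENorm_form α M

theorem isClosed_consistent_pair (M N : ℕ) :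
    IsClosed {x : LatticeFamily d E | x M = ((x.form N).restrict M).val} := by
  refine isClosed_eq (continuous_apply M) (continuous_pi fun y => continuous_pi fun μ => ?_)
  exact (DiscreteOneForm.continuous_val y μ).comp
    (DiscreteOneForm.continuous_restrict.comp (continuous_form N))

theorem isClosed_isConsistent : IsClosed {x : LatticeFamily d E | x.IsConsistent} := by
  simp only [IsConsistent, Set.ofPred_forall]
  exact isClosed_iInter fun M => isClosed_iInter fun N => isClosed_iInter fun _ =>
    isClosed_consistent_pair M N

theorem isClosed_consistent_bounded (α K : ℝ) :
    IsClosed {x : LatticeFamily d E | x.IsConsistent ∧ x.totalNorm α ≤ ENNReal.ofReal K} :=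
  isClosed_isConsistent.inter ((lowerSemicontinuous_totalNorm α).isClosed_preimage _)

theorem IsConsistent.isBounded {x : LatticeFamily d E} (hx : x.IsConsistent) {α K : ℝ} (hK : 0 ≤ K)
    (h : x.totalNorm α ≤ ENNReal.ofReal K) : x.IsBounded α K := by
  rw [← hx.growth_add_rhoNorm] at h
  exact ⟨hx, hK, le_self_add.trans h, le_add_self.trans h⟩

theorem norm_approx_sub_approx_le (x y : LatticeFamily d E) (M : ℕ) (p : Torus d) (μ : Fin d)
    {lam : ℝ} (h1 : lam ≤ 1) :
    ‖x.approx M p μ lam - y.approx M p μ lam‖ ≤ 2 ^ M * dist (x M) (y M) := by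
  rw [approx_eq_sum_range, approx_eq_sum_range, ← Finset.sum_sub_distrib]
  refine (norm_sum_le_of_le _ (n := fun _ => dist (x M) (y M)) fun i _ => ?_).trans ?_
  · rw [form_val, form_val, ← dist_eq_norm]
    exact (dist_le_pi_dist _ _ μ).trans (dist_le_pi_dist (x M) (y M) _)
  · rw [Finset.sum_const, Finset.card_range, nsmul_eq_mul]
    refine mul_le_mul_of_nonneg_right ?_ dist_nonneg
    exact_mod_cast floorCount_le (circleLift (p μ)) h1

/-- On bounded sets of consistent families the extension is continuous for uniform convergence on
all segments. -/
theorem eventually_norm_extend_sub_le [CompleteSpace E] {α K : ℝ} (hα : 0 < α)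
    {x : LatticeFamily d E} (hx : x.IsBounded α K) {ε : ℝ} (hε : 0 < ε) :
    ∀ᶠ y in 𝓝 x, y.IsBounded α K → ∀ ℓ, ‖y.extend ℓ - x.extend ℓ‖ ≤ ε := by
  set q := (2 : ℝ)⁻¹ ^ (α / 2)
  set C := K * ((2 * d : ℝ) ^ (α / 2) + 2)
  have hlim : Tendsto (fun M : ℕ => C * q ^ M / (1 - q)) atTop (𝓝 0) := by
    have := ((tendsto_pow_atTop_nhds_zero_of_lt_one (by positivity) (ratio_lt_one hα)).const_mul
      C).div_const (1 - q)
    rwa [mul_zero, zero_div] at this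
  obtain ⟨M, hM⟩ := (hlim.eventually_lt_const (show (0 : ℝ) < ε / 3 by positivity)).exists
  have hcont : Tendsto (fun y : LatticeFamily d E => 2 ^ M * dist (y M) (x M)) (𝓝 x) (𝓝 0) := by
    have : Continuous fun y : LatticeFamily d E => 2 ^ M * dist (y M) (x M) :=
      ((continuous_apply M).dist continuous_const).const_mul _
    simpa using this.tendsto x
  filter_upwards [hcont.eventually_lt_const (show (0 : ℝ) < ε / 3 by positivity)] with y hy hyB ℓ
  rcases ℓ.length_nonneg.eq_or_lt with h0 | h0
  · rw [extend, extend, if_pos h0.symm, if_pos h0.symm, sub_zero, norm_zero]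
    exact hε.le
  obtain ⟨p, μ, hp⟩ := ℓ.exists_carrier_eq
  have e1 : _ ≤ C * q ^ M / (1 - q) := hx.dist_approx_extend_le hα h0 hp M
  have e2 : _ ≤ C * q ^ M / (1 - q) := hyB.dist_approx_extend_le hα h0 hp M
  have e3 := norm_approx_sub_approx_le y x M p μ ℓ.length_le_one
  rw [← dist_eq_norm] at e3 ⊢
  rw [dist_comm] at e2
  have := dist_triangle4 (y.extend ℓ) (y.approx M p μ ℓ.length) (x.approx M p μ ℓ.length)
    (x.extend ℓ)
  linarith

section Omega

variable [NormedSpace ℝ E] [CompleteSpace E] {α : ℝ}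

open Classical in
/-- The element of `Ω_α` that extends a consistent family of finite norm; `0` for other families. -/
noncomputable def toOmega (hα : 0 < α) (x : LatticeFamily d E) : Omega d E α :=
  if h : x.IsConsistent ∧ x.totalNorm α < ⊤ then
    have hb := h.1.isBounded ENNReal.toReal_nonneg (ENNReal.ofReal_toReal h.2.ne).ge
    Omega.ofAdditive x.extend (hb.additive_extend hα) ((hb.segmentENorm_extend_le hα).trans_lt h.2)
  else 0

theorem toFun_toOmega (hα : 0 < α) {x : LatticeFamily d E} (h : x.IsConsistent)
    (h' : x.totalNorm α < ⊤) : (x.toOmega hα).toFun = x.extend := by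
  rw [toOmega, dif_pos ⟨h, h'⟩]
  rfl

theorem toOmega_of_not (hα : 0 < α) {x : LatticeFamily d E}
    (h : ¬ (x.IsConsistent ∧ x.totalNorm α < ⊤)) : x.toOmega hα = 0 := by
  rw [toOmega, dif_neg h]

theorem norm_toOmega_le (hα : 0 < α) {x : LatticeFamily d E} (h : x.IsConsistent)
    (h' : x.totalNorm α < ⊤) : ‖x.toOmega hα‖ ≤ (x.totalNorm α).toReal := by
  rw [Omega.norm_def, toFun_toOmega hα h h']
  exact ENNReal.toReal_mono h'.ne ((h.isBounded ENNReal.toReal_nonneg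
    (ENNReal.ofReal_toReal h'.ne).ge).segmentENorm_extend_le hα)

theorem ofSegments_toOmega (hα : 0 < α) {x : LatticeFamily d E} (h : x.IsConsistent)
    (h' : x.totalNorm α < ⊤) (M : ℕ) :
    DiscreteOneForm.ofSegments M (x.toOmega hα).toFun = x.form M := by
  rw [toFun_toOmega hα h h', DiscreteOneForm.ofSegments, form]
  congr 1
  funext y μ
  exact (h.isBounded ENNReal.toReal_nonneg (ENNReal.ofReal_toReal h'.ne).ge).extend_segment hα M y μ

theorem continuousOn_inclusion_toOmega {β : ℝ} (hβ : 0 ≤ β) (hβα : β < α) {K : ℝ} (hK : 0 ≤ K) :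
    ContinuousOn (fun x : LatticeFamily d E =>
        (x.toOmega (hβ.trans_lt hβα)).inclusion hβ hβα.le)
      {x | x.IsConsistent ∧ x.totalNorm α ≤ ENNReal.ofReal K} := by
  have hα : 0 < α := hβ.trans_lt hβα
  have hθ : 0 < 1 - β / α := by
    rw [sub_pos, div_lt_one hα]
    exact hβα
  have hnorm : ∀ x : LatticeFamily d E, x.IsConsistent → x.totalNorm α ≤ ENNReal.ofReal K →
      ‖x.toOmega hα‖ ≤ K := fun x h h' =>
    (norm_toOmega_le hα h (h'.trans_lt ENNReal.ofReal_lt_top)).trans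
      (ENNReal.toReal_le_of_le_ofReal hK h')
  rintro x ⟨hx, hx'⟩
  refine Metric.tendsto_nhds.2 fun η hη => ?_
  have hlim : Tendsto (fun ε : ℝ => 2 * ((K + K) ^ (β / α) * (2 * ε) ^ (1 - β / α))) (𝓝[>] 0)
      (𝓝 0) := by
    have h1 : Tendsto (fun ε : ℝ => 2 * ε) (𝓝[>] 0) (𝓝 0) := by
      have : Continuous fun ε : ℝ => 2 * ε := by fun_prop
      simpa using (this.tendsto 0).mono_left nhdsWithin_le_nhds
    have h2 := ((h1.rpow_const (p := 1 - β / α) (Or.inr hθ.le)).const_mul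
      ((K + K) ^ (β / α))).const_mul 2
    rwa [Real.zero_rpow hθ.ne', mul_zero, mul_zero] at h2
  obtain ⟨ε, hεη, hε⟩ := ((hlim.eventually_lt_const hη).and self_mem_nhdsWithin).exists
  have hev := eventually_norm_extend_sub_le hα (hx.isBounded hK hx') hε
  filter_upwards [mem_nhdsWithin_of_mem_nhds hev, self_mem_nhdsWithin] with y hy hyS
  obtain ⟨hy1, hy2⟩ := hyS
  rw [dist_eq_norm]
  refine lt_of_le_of_lt (Omega.norm_inclusion_le hβ hβα (y.toOmega hα - x.toOmega hα)
    (K := K + K) (ε := ε) ?_ (le_of_lt hε) fun ℓ => ?_) hεη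
  · exact (norm_sub_le _ _).trans (add_le_add (hnorm y hy1 hy2) (hnorm x hx hx'))
  · change ‖(y.toOmega hα).toFun ℓ - (x.toOmega hα).toFun ℓ‖ ≤ ε
    rw [toFun_toOmega hα hy1 (hy2.trans_lt ENNReal.ofReal_lt_top),
      toFun_toOmega hα hx (hx'.trans_lt ENNReal.ofReal_lt_top)]
    exact hy (hy1.isBounded hK hy2) ℓ

theorem measurable_inclusion_toOmega [MeasurableSpace (LatticeFamily d E)]
    [BorelSpace (LatticeFamily d E)] {β : ℝ} (hβ : 0 ≤ β) (hβα : β < α) :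
    Measurable fun x : LatticeFamily d E =>
      (x.toOmega (hβ.trans_lt hβα)).inclusion hβ hβα.le := by
  set f := fun x : LatticeFamily d E => (x.toOmega (hβ.trans_lt hβα)).inclusion hβ hβα.le with hf
  set S : ℕ → Set (LatticeFamily d E) :=
    fun n => {x | x.IsConsistent ∧ x.totalNorm α ≤ ENNReal.ofReal n}
  have hS : ∀ n, MeasurableSet (S n) := fun n => (isClosed_consistent_bounded α n).measurableSet
  refine measurable_of_isOpen fun U hU => ?_
  have hcov : f ⁻¹' U = (⋃ n, f ⁻¹' U ∩ S n) ∪ (f ⁻¹' U ∩ (⋃ n, S n)ᶜ) := by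
    rw [← Set.inter_iUnion, Set.inter_union_compl]
  rw [hcov]
  refine (MeasurableSet.iUnion fun n => ?_).union ?_
  · obtain ⟨V, hV, hVe⟩ := continuousOn_iff'.1
      (continuousOn_inclusion_toOmega (d := d) (E := E) hβ hβα (Nat.cast_nonneg n)) U hU
    rw [hf, hVe]
    exact hV.measurableSet.inter (hS n)
  · -- outside the consistent families of finite norm the map vanishes
    have h0 : ∀ x ∈ (⋃ n, S n)ᶜ, x.toOmega (hβ.trans_lt hβα) = 0 := by
      intro x hx
      refine toOmega_of_not _ fun h => hx ?_
      obtain ⟨n, hn⟩ := exists_nat_ge (x.totalNorm α).toReal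
      refine Set.mem_iUnion.2 ⟨n, h.1, ?_⟩
      rw [← ENNReal.ofReal_toReal h.2.ne]
      exact ENNReal.ofReal_le_ofReal hn
    by_cases hU0 : (0 : Omega d E α).inclusion hβ hβα.le ∈ U
    · have : f ⁻¹' U ∩ (⋃ n, S n)ᶜ = (⋃ n, S n)ᶜ :=
        Set.inter_eq_right.2 fun x hx => by
          change (x.toOmega _).inclusion hβ hβα.le ∈ U
          rwa [h0 x hx]
      rw [this]
      exact (MeasurableSet.iUnion hS).compl
    · have : f ⁻¹' U ∩ (⋃ n, S n)ᶜ = ∅ :=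
        Set.eq_empty_of_forall_notMem fun x hx => hU0 (by
          have h1 : (x.toOmega _).inclusion hβ hβα.le ∈ U := hx.1
          rwa [h0 x hx.2] at h1)
      rw [this]
      exact MeasurableSet.empty

end Omega

end LatticeFamily

/-! ### Weak limits of random one-forms -/

namespace LatticeFamily

variable {d : ℕ} {E : Type*} [NormedAddCommGroup E] {M N : ℕ}

/-- The restrictions of a one-form on `Λ_N` to all coarser lattices, completed by `0` on the finer
ones. -/
noncomputable def ofDiscrete (A : DiscreteOneForm d E N) : LatticeFamily d E :=
  fun M => if M ≤ N then (A.restrict M).val else 0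

theorem form_ofDiscrete (h : M ≤ N) (A : DiscreteOneForm d E N) :
    (ofDiscrete A).form M = A.restrict M := by
  rw [form, ofDiscrete, if_pos h, DiscreteOneForm.ofVal_val]

theorem continuous_ofDiscrete :
    Continuous (ofDiscrete : DiscreteOneForm d E N → LatticeFamily d E) := by
  refine continuous_pi fun M => ?_
  unfold ofDiscrete
  by_cases h : M ≤ N
  · simp only [h, if_true]
    exact continuous_pi fun y => continuous_pi fun μ =>
      (DiscreteOneForm.continuous_val y μ).comp DiscreteOneForm.continuous_restrict
  · simp only [h, if_false]
    exact continuous_const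

theorem ofDiscrete_consistent {L : ℕ} (h : L ≤ M) (h' : M ≤ N) (A : DiscreteOneForm d E N) :
    ofDiscrete A L = (((ofDiscrete A).form M).restrict L).val := by
  rw [form_ofDiscrete h', DiscreteOneForm.restrict_restrict h h', ofDiscrete, if_pos (h.trans h')]

theorem totalNorm_ofDiscrete_le (α : ℝ) (A : DiscreteOneForm d E N) :
    (ofDiscrete A).totalNorm α ≤ segmentENorm α (latticeSegments d N) A.onSegments := by
  refine iSup_le fun M => ?_
  by_cases h : M ≤ N
  · rw [form_ofDiscrete h]
    exact add_le_add (DiscreteOneForm.growthENorm_restrict_le α h A)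
      (DiscreteOneForm.rhoENorm_restrict_le α h A)
  · have h0 : ((ofDiscrete A).form M).onSegments = 0 := by
      funext ℓ
      refine Finset.sum_eq_zero fun b _ => ?_
      rw [form_val, ofDiscrete, if_neg h]
      exact ite_self _
    rw [h0, segmentENorm_zero]
    exact zero_le

theorem norm_ofDiscrete_le {α R : ℝ} (hα : 0 ≤ α) (hR : 0 ≤ R) {A : DiscreteOneForm d E N}
    (hA : A.latticeNorm α ≤ R) (M : ℕ) (y : DyadicLattice d M) (μ : Fin d) :
    ‖ofDiscrete A M y μ‖ ≤ R := by
  have h1 : segmentENorm α (latticeSegments d N) A.onSegments ≤ ENNReal.ofReal R :=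
    not_lt.1 fun h => hA.not_gt ((DiscreteOneForm.lt_latticeNorm_iff hR A).2 h)
  have h2 : (ofDiscrete A).growth α ≤ ENNReal.ofReal R :=
    (iSup_mono fun M => le_self_add).trans ((totalNorm_ofDiscrete_le α A).trans h1)
  refine (norm_apply_le hR h2 M y μ).trans (mul_le_of_le_one_right hR ?_)
  exact Real.rpow_le_one (by positivity) (inv_le_one_of_one_le₀ (one_le_pow₀ one_le_two)) hα

theorem isCompact_norm_le [ProperSpace E] (R : ℝ) :
    IsCompact {x : LatticeFamily d E | ∀ M y μ, ‖x M y μ‖ ≤ R} := by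
  have h : {x : LatticeFamily d E | ∀ M y μ, ‖x M y μ‖ ≤ R} = Set.univ.pi fun M =>
      Set.univ.pi fun _ : DyadicLattice d M => Set.univ.pi fun _ : Fin d =>
        Metric.closedBall (0 : E) R := by
    ext x
    simp [Set.mem_pi]
  rw [h]
  exact isCompact_univ_pi fun M => isCompact_univ_pi fun _ => isCompact_univ_pi fun _ =>
    isCompact_closedBall _ _

end LatticeFamily

theorem exists_tail_bound_of_isTightMeasureSet {ι : Type*} {S : ι → Type*}
    [∀ i, MeasurableSpace (S i)] {P : ∀ i, Measure (S i)} {f : ∀ i, S i → ℝ}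
    (hf : ∀ i, Measurable (f i))
    (h : IsTightMeasureSet (Set.range fun i => (P i).map (f i))) {ε : ℝ≥0∞} (hε : 0 < ε) :
    ∃ R : ℝ, 0 ≤ R ∧ ∀ i, P i {ω | R < f i ω} ≤ ε := by
  obtain ⟨C, hC, hP⟩ := isTightMeasureSet_iff_exists_isCompact_measure_compl_le.1 h ε hε
  obtain ⟨R, hR⟩ := hC.isBounded.exists_norm_le
  refine ⟨max R 0, le_max_right _ _, fun i => ?_⟩
  refine le_trans ?_ (hP _ ⟨i, rfl⟩)
  rw [Measure.map_apply (hf i) hC.isClosed.measurableSet.compl]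
  refine measure_mono fun ω hω hmem => ?_
  have h1 := (le_abs_self _).trans (hR _ hmem)
  exact (lt_of_le_of_lt (le_max_left R 0) hω).not_ge h1

/-- The laws of the families `ofDiscrete (A N)` have a weakly convergent subsequence. -/
theorem exists_subseq_tendsto_law {d : ℕ} {E : Type*} [NormedAddCommGroup E] [ProperSpace E]
    [MeasurableSpace (LatticeFamily d E)] [BorelSpace (LatticeFamily d E)]
    {α : ℝ} (hα : 0 ≤ α) {S : ℕ → Type*} [∀ N, MeasurableSpace (S N)]
    (P : ∀ N, Measure (S N)) [∀ N, IsProbabilityMeasure (P N)]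
    (A : ∀ N, S N → DiscreteOneForm d E N) (hA : ∀ N, Measurable (A N))
    (htight : IsTightMeasureSet (Set.range fun N => (P N).map fun ω => (A N ω).latticeNorm α)) :
    ∃ (φ : ℕ → ℕ) (Q : Measure (LatticeFamily d E)) (_ : IsProbabilityMeasure Q), StrictMono φ ∧
      TendstoInDistribution (fun k ω => LatticeFamily.ofDiscrete (A (φ k) ω)) atTop id
        (fun k => P (φ k)) Q := by
  have hX : ∀ N, Measurable fun ω => LatticeFamily.ofDiscrete (A N ω) := fun N =>
    LatticeFamily.continuous_ofDiscrete.measurable.comp (hA N)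
  let law : ℕ → ProbabilityMeasure (LatticeFamily d E) := fun N =>
    ⟨(P N).map fun ω => LatticeFamily.ofDiscrete (A N ω),
      Measure.isProbabilityMeasure_map (hX N).aemeasurable⟩
  have hlaw : IsTightMeasureSet
      {((μ : ProbabilityMeasure (LatticeFamily d E)) : Measure (LatticeFamily d E)) |
        μ ∈ Set.range law} := by
    rw [isTightMeasureSet_iff_exists_isCompact_measure_compl_le]
    intro ε hε
    obtain ⟨R, hR, htail⟩ := exists_tail_bound_of_isTightMeasureSet
      (fun N => (DiscreteOneForm.measurable_latticeNorm α).comp (hA N)) htight hε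
    refine ⟨_, LatticeFamily.isCompact_norm_le R, ?_⟩
    rintro _ ⟨_, ⟨N, rfl⟩, rfl⟩
    change (P N).map _ _ ≤ ε
    rw [Measure.map_apply (hX N) (LatticeFamily.isCompact_norm_le R).isClosed.measurableSet.compl]
    refine (measure_mono fun ω hω => ?_).trans (htail N)
    by_contra hlt
    exact hω (LatticeFamily.norm_ofDiscrete_le hα hR (not_lt.1 hlt))
  obtain ⟨Q, -, φ, hφ, hlim⟩ := (isCompact_closure_of_isTightMeasureSet hlaw).isSeqCompact
    (fun N => subset_closure (Set.mem_range_self N))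
  refine ⟨φ, Q, inferInstance, hφ, fun k => (hX _).aemeasurable, aemeasurable_id, ?_⟩
  have e : (⟨(Q : Measure (LatticeFamily d E)).map id,
      Measure.isProbabilityMeasure_map aemeasurable_id⟩ :
      ProbabilityMeasure (LatticeFamily d E)) = Q := Subtype.ext Measure.map_id
  rw [e]
  exact hlim

theorem measure_le_liminf_of_isOpen {X : Type*} [TopologicalSpace X] [MeasurableSpace X]
    [BorelSpace X] [HasOuterApproxClosed X] {S : ℕ → Type*} [∀ k, MeasurableSpace (S k)]
    {P : ∀ k, Measure (S k)} [∀ k, IsProbabilityMeasure (P k)] {Q : Measure X}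
    [IsProbabilityMeasure Q] {Y : ∀ k, S k → X} (h : TendstoInDistribution Y atTop id P Q)
    {G : Set X} (hG : IsOpen G) : Q G ≤ liminf (fun k => P k (Y k ⁻¹' G)) atTop := by
  have := ProbabilityMeasure.le_liminf_measure_open_of_tendsto h.tendsto hG
  simp only [ProbabilityMeasure.coe_mk, Measure.map_id] at this
  refine this.trans (le_of_eq (liminf_congr (Eventually.of_forall fun k => ?_)))
  exact Measure.map_apply_of_aemeasurable (h.forall_aemeasurable k) hG.measurableSet

theorem theorem3p15 {d : ℕ} (hd : 1 ≤ d)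
    {E : Type u} [NormedAddCommGroup E] [NormedSpace ℝ E] [FiniteDimensional ℝ E]
    {β α : ℝ} (hβ : 0 ≤ β) (hβα : β < α) (hα : α ≤ 1)
    {S : ℕ → Type v} [∀ N, MeasurableSpace (S N)]
    (P : ∀ N, Measure (S N)) [∀ N, IsProbabilityMeasure (P N)]
    (A : ∀ N, S N → DiscreteOneForm d E N) (hA : ∀ N, Measurable (A N))
    (htight : IsTightMeasureSet
      (Set.range fun N => (P N).map fun ω => (A N ω).latticeNorm α)) :
    ∃ (φ : ℕ → ℕ) (S' : Type u) (_ : MeasurableSpace S') (P' : Measure S')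
      (_ : IsProbabilityMeasure P') (A' : S' → Omega d E α),
      StrictMono φ ∧
      Measurable (fun ω => (A' ω).inclusion hβ hβα.le) ∧
      (∀ M : ℕ, TendstoInDistribution
        (fun k (ω : S (φ k)) => (A (φ k) ω).restrict M) atTop
        (fun ω => DiscreteOneForm.ofSegments M (A' ω).toFun)
        (fun k => P (φ k)) P') ∧
      ∀ K : ℝ, 0 ≤ K →
        P' {ω | K < ‖A' ω‖} ≤
          limsup (fun k => P (φ k) {ω | K < (A (φ k) ω).latticeNorm α}) atTop := by
  have hα0 : 0 < α := hβ.trans_lt hβα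
  have : ProperSpace E := FiniteDimensional.proper ℝ E
  have : CompleteSpace E := FiniteDimensional.complete ℝ E
  let _ : MeasurableSpace (LatticeFamily d E) := borel _
  have : BorelSpace (LatticeFamily d E) := ⟨rfl⟩
  obtain ⟨φ, Q, hQ, hφ, hlim⟩ := exists_subseq_tendsto_law hα0.le P A hA htight
  have htail : ∀ K : ℝ, 0 ≤ K → Q {x | ENNReal.ofReal K < x.totalNorm α} ≤
      liminf (fun k => P (φ k) {ω | K < (A (φ k) ω).latticeNorm α}) atTop := fun K hK =>
    (measure_le_liminf_of_isOpen hlim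
      ((LatticeFamily.lowerSemicontinuous_totalNorm α).isOpen_preimage _)).trans
      (liminf_le_liminf (Eventually.of_forall fun k => measure_mono fun ω hω =>
        (DiscreteOneForm.lt_latticeNorm_iff hK _).2
          (lt_of_lt_of_le hω (LatticeFamily.totalNorm_ofDiscrete_le α _))))
  have hcons : ∀ᵐ x ∂Q, x.IsConsistent := by
    simp only [LatticeFamily.IsConsistent, ae_all_iff]
    intro M N hMN
    refine le_antisymm ?_ zero_le
    refine (measure_le_liminf_of_isOpen hlim
      (LatticeFamily.isClosed_consistent_pair M N).isOpen_compl).trans (le_of_eq ?_)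
    refine (liminf_congr ?_).trans (liminf_const (0 : ℝ≥0∞))
    filter_upwards [eventually_ge_atTop N] with k hk
    refine measure_mono_null (fun ω hω => hω ?_) measure_empty
    exact LatticeFamily.ofDiscrete_consistent hMN (hk.trans hφ.le_apply) _
  have hfin : ∀ᵐ x ∂Q, x.totalNorm α < ⊤ := by
    refine le_antisymm (le_of_forall_pos_le_add fun ε hε => ?_) zero_le
    obtain ⟨R, hR, hRε⟩ := exists_tail_bound_of_isTightMeasureSet
      (fun N => (DiscreteOneForm.measurable_latticeNorm α).comp (hA N)) htight hε
    rw [zero_add]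
    refine (measure_mono fun x hx => ?_).trans ((htail R hR).trans
      ((liminf_le_liminf (Eventually.of_forall fun k => hRε (φ k))).trans
        (liminf_const ε).le))
    exact ENNReal.ofReal_lt_top.trans_le (not_lt.1 hx)
  refine ⟨φ, LatticeFamily d E, inferInstance, Q, hQ, fun x => x.toOmega hα0, hφ,
    LatticeFamily.measurable_inclusion_toOmega hβ hβα, fun M => ?_, fun K hK => ?_⟩
  · have h1 := (hlim.continuous_comp (LatticeFamily.continuous_form M)).congr
      (fun k => EventuallyEq.rfl)
      (T := fun x => DiscreteOneForm.ofSegments M (x.toOmega hα0).toFun) (by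
        filter_upwards [hcons, hfin] with x hx hx'
        exact (LatticeFamily.ofSegments_toOmega hα0 hx hx' M).symm)
    refine ⟨fun k => (DiscreteOneForm.continuous_restrict.measurable.comp (hA _)).aemeasurable,
      h1.aemeasurable_limit, h1.tendsto.congr' ?_⟩
    filter_upwards [eventually_ge_atTop M] with k hk
    refine Subtype.ext (congrArg (fun f => (P (φ k)).map f) (funext fun ω => ?_))
    exact LatticeFamily.form_ofDiscrete (hk.trans hφ.le_apply) _
  · refine ((measure_mono fun x hx => ?_).trans (htail K hK)).trans liminf_le_limsup
    have hx : K < ‖x.toOmega hα0‖ := hx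
    by_cases h : x.IsConsistent ∧ x.totalNorm α < ⊤
    · exact (ENNReal.ofReal_lt_iff_lt_toReal hK h.2.ne).2
        (hx.trans_le (LatticeFamily.norm_toOmega_le hα0 h.1 h.2))
    · rw [LatticeFamily.toOmega_of_not hα0 h, norm_zero] at hx
      exact absurd hx hK.not_gt
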